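/- Let $S$ be a smooth finite dimensional manifold and let $E\to S$ be a smooth real vector bundle of finite rank. Let $\Pi$ be a Poisson bivector field on the total space $E$, with Poisson bracket $[f,g]_\Pi=\langle \Pi^{\#}(df),dg\rangle$, and assume that $S$, embedded in $E$ as the zero section, is coisotropic, i.e. $\Pi^{\#}$ maps the conormal bundle $N^*S$ into $TS$. Let $\mathcal E\to E$ be the pullback of $E\to S$ along the projection $E\to S$, let $\mathcal E^*$ be its dual, and let $$BFV(E,\Pi)=\Gamma\big(\textstyle\bigwedge\mathcal E\otimes\bigwedge\mathcal E^*\big),\qquad BFV^{(p,q)}(E,\Pi)=\Gamma\big(\textstyle\bigwedge^p\mathcal E\otimes\bigwedge^q\mathcal E^*\big),$$ with the product of the graded tensor product. An element is of degree $k$ if it lies in $BFV^k(E,\Pi)=\bigoplus_{p-q=k}BFV^{(p,q)}(E,\Pi)$, and we put $BFV_{\ge r}(E,\Pi)=\Gamma(\bigwedge\mathcal E\otimes\bigwedge^{\ge r}\mathcal E^*)$. Let $[-,-]_{BFV}$ be any bracket making $BFV(E,\Pi)$ a graded Poisson algebra (that is, an $\mathbb R$-bilinear bracket of degree $0$ with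 $[x,y]=-(-1)^{|x||y|}[y,x]$, $[x,[y,z]]=[[x,y],z]+(-1)^{|x||y|}[y,[x,z]]$ and $[x,y\cdot z]=[x,y]\cdot z+(-1)^{|x||y|}y\cdot[x,z]$) such that 1. for all $f,g\in C^\infty(E)$ the component of $[f,g]_{BFV}$ in $BFV^{(0,0)}(E,\Pi)=C^\infty(E)$ is $[f,g]_\Pi$, and 2. for all $a\in\Gamma(\mathcal E)$ and $\alpha\in\Gamma(\mathcal E^*)$ the component of $[a,\alpha]_{BFV}$ in $BFV^{(0,0)}(E,\Pi)$ is the fibre pairing $\langle\alpha,a\rangle$. Then there is an element $\Omega\in BFV(E,\Pi)$ of degree $+1$ such that $[\Omega,\Omega]_{BFV}=0$ and $\Omega\equiv\Omega_0$ modulo $BFV_{\ge1}(E,\Pi)$, where $\Omega_0\in\Gamma(\mathcal E)=BFV^{(1,0)}(E,\Pi)$, $\Omega_0(v)=v$, is the tautological section. -/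

import Mathlib

open scoped Manifold ContDiff
open Bundle

/-! ### Graded Poisson algebras -/

section GradedPoisson

/-- Let `A` be an `ℝ`-algebra with a family `𝒜 k` (`k : ℤ`) of subspaces of homogeneous elements.
A graded Poisson bracket on `A` is a bilinear map of degree `0` that is graded skew-symmetric and
satisfies the graded Jacobi identity and the graded Leibniz rule. -/
structure IsGradedPoissonBracket {A : Type*} [Ring A] [Algebra ℝ A] (𝒜 : ℤ → Submodule ℝ A)
    (br : A →ₗ[ℝ] A →ₗ[ℝ] A) : Prop where
  degree : ∀ (k l : ℤ) (x y : A), x ∈ 𝒜 k → y ∈ 𝒜 l → br x y ∈ 𝒜 (k + l)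
  skew : ∀ (k l : ℤ) (x y : A), x ∈ 𝒜 k → y ∈ 𝒜 l →
    br x y = -(((k * l).negOnePow : ℤ) • br y x)
  jacobi : ∀ (k l : ℤ) (x y z : A), x ∈ 𝒜 k → y ∈ 𝒜 l →
    br x (br y z) = br (br x y) z + ((k * l).negOnePow : ℤ) • br y (br x z)
  leibniz : ∀ (k l : ℤ) (x y z : A), x ∈ 𝒜 k → y ∈ 𝒜 l →
    br x (y * z) = br x y * z + ((k * l).negOnePow : ℤ) • (y * br x z)

end GradedPoisson

/-! ### Poisson manifolds and coisotropic submanifolds -/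

section PoissonManifold

variable {EM : Type*} [NormedAddCommGroup EM] [NormedSpace ℝ EM]
  {HM : Type*} [TopologicalSpace HM] (I : ModelWithCorners ℝ EM HM)
  {M : Type*} [TopologicalSpace M] [ChartedSpace HM M]

/-- The differential `df` at the point `v`, a covector at `v`. -/
noncomputable def covectorOf (f : M → ℝ) (v : M) : TangentSpace I v →L[ℝ] ℝ :=
  (mfderiv I 𝓘(ℝ, ℝ) f v : TangentSpace I v →L[ℝ] TangentSpace 𝓘(ℝ, ℝ) (f v))

/-- The function `⟨Π♯(df), dg⟩` determined by a (pointwise linear) map `Π♯ : T*M → TM`. -/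
noncomputable def sharpBracket
    (sharp : ∀ v : M, (TangentSpace I v →L[ℝ] ℝ) →ₗ[ℝ] TangentSpace I v)
    (f g : M → ℝ) : M → ℝ :=
  fun v => covectorOf I g v (sharp v (covectorOf I f v))

variable (M) in
/-- A smooth Poisson bivector field `Π` on a finite dimensional manifold `M`, given by the
contraction `Π♯ : T*M → TM`. Skew-symmetry of `Π♯` says that `Π` is a bivector at every point,
smoothness of `Π` is tested on differentials of smooth functions, and `[Π, Π] = 0` is expressed
by the Jacobi identity of the bracket `[f, g] = ⟨Π♯(df), dg⟩`. -/
structure PoissonStructure where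
  /-- The contraction `Π♯ : T*M → TM`. -/
  sharp : ∀ v : M, (TangentSpace I v →L[ℝ] ℝ) →ₗ[ℝ] TangentSpace I v
  skew : ∀ (v : M) (α β : TangentSpace I v →L[ℝ] ℝ), β (sharp v α) = -α (sharp v β)
  smooth : ∀ f g : M → ℝ, ContMDiff I 𝓘(ℝ, ℝ) ∞ f → ContMDiff I 𝓘(ℝ, ℝ) ∞ g →
    ContMDiff I 𝓘(ℝ, ℝ) ∞ (sharpBracket I sharp f g)
  jacobi : ∀ f g h : M → ℝ, ContMDiff I 𝓘(ℝ, ℝ) ∞ f → ContMDiff I 𝓘(ℝ, ℝ) ∞ g →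
    ContMDiff I 𝓘(ℝ, ℝ) ∞ h → ∀ v : M,
      sharpBracket I sharp f (sharpBracket I sharp g h) v +
        sharpBracket I sharp g (sharpBracket I sharp h f) v +
        sharpBracket I sharp h (sharpBracket I sharp f g) v = 0

variable {I}

/-- The Poisson bracket `[f, g] = ⟨Π♯(df), dg⟩` of two functions. -/
noncomputable def PoissonStructure.bracket (P : PoissonStructure I M) (f g : M → ℝ) : M → ℝ :=
  sharpBracket I P.sharp f g

/-- The submanifold given by an embedding `i : S → M` is coisotropic: `Π♯` maps the conormal
space (the annihilator of the tangent space of `S`) into the tangent space of `S`. -/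
def PoissonStructure.IsCoisotropic (P : PoissonStructure I M)
    {ES : Type*} [NormedAddCommGroup ES] [NormedSpace ℝ ES]
    {HS : Type*} [TopologicalSpace HS] (J : ModelWithCorners ℝ ES HS)
    {S : Type*} [TopologicalSpace S] [ChartedSpace HS S] (i : S → M) : Prop :=
  ∀ (x : S) (α : TangentSpace I (i x) →L[ℝ] ℝ),
    (∀ u : TangentSpace J x, α (mfderiv J I i x u) = 0) →
      ∃ u : TangentSpace J x, mfderiv J I i x u = P.sharp (i x) α

end PoissonManifold

/-! ### The fibres of the ghost / ghost-momentum algebra -/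

section GhostAlgebra

/-- `⋀(W ⊕ W*)`, i.e. the graded tensor product `⋀W ⊗ ⋀W*`. -/
abbrev GhostAlgebra (W : Type*) [AddCommGroup W] [Module ℝ W] : Type _ :=
  ExteriorAlgebra ℝ (W × Module.Dual ℝ W)

variable {W W' : Type*} [AddCommGroup W] [Module ℝ W] [AddCommGroup W'] [Module ℝ W']

/-- The inclusion of `W`: generators of bidegree `(1, 0)`. -/
noncomputable def ghost : W →ₗ[ℝ] GhostAlgebra W :=
  ExteriorAlgebra.ι ℝ ∘ₗ LinearMap.inl ℝ W (Module.Dual ℝ W)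

/-- The inclusion of `W*`: generators of bidegree `(0, 1)`. -/
noncomputable def ghostMomentum : Module.Dual ℝ W →ₗ[ℝ] GhostAlgebra W :=
  ExteriorAlgebra.ι ℝ ∘ₗ LinearMap.inr ℝ W (Module.Dual ℝ W)

variable (W) in
/-- The component `⋀^p W ⊗ ⋀^q W*`. -/
noncomputable def ghostBidegree (p q : ℕ) : Submodule ℝ (GhostAlgebra W) :=
  LinearMap.range (ghost (W := W)) ^ p * LinearMap.range (ghostMomentum (W := W)) ^ q

variable (W) in
/-- The subspace `⋀W ⊗ ⋀^{≥ r} W*`. -/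
noncomputable def ghostGE (r : ℕ) : Submodule ℝ (GhostAlgebra W) :=
  ⨆ (p : ℕ) (q : ℕ) (_ : r ≤ q), ghostBidegree W p q

/-- The algebra map `⋀(W ⊕ W*) → ⋀(W' ⊕ W'*)` induced by `A : W → W'` on `W` and by the transpose
of `B : W' → W` on `W*` (in use, `B` is the inverse of `A`). -/
noncomputable def ghostMap (A : W →ₗ[ℝ] W') (B : W' →ₗ[ℝ] W) :
    GhostAlgebra W →ₐ[ℝ] GhostAlgebra W' :=
  ExteriorAlgebra.map (A.prodMap B.dualMap)

theorem linearForm_mul_eq_sum {A ι : Type*} [Ring A] [Algebra ℝ A] [Fintype ι]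
    (b : Module.Basis ι ℝ A) (φ : Module.Dual ℝ A) (s t : A) :
    φ (s * t) = ∑ i, ∑ j, (b.coord i s * b.coord j t) * φ (b i * b j) := by
  conv_lhs => rw [← b.sum_repr s, ← b.sum_repr t]
  rw [Finset.sum_mul, map_sum]
  refine Finset.sum_congr rfl fun i _ => ?_
  rw [Finset.mul_sum, map_sum]
  refine Finset.sum_congr rfl fun j _ => ?_
  rw [smul_mul_smul_comm, map_smul, smul_eq_mul]
  rfl

instance ghostAlgebra_finite [FiniteDimensional ℝ W] : Module.Finite ℝ (GhostAlgebra W) :=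
  Module.Finite.of_basis
    (Module.finBasis ℝ (W × Module.Dual ℝ W)).ExteriorAlgebra

end GhostAlgebra

/-! ### The graded algebra `BFV(E)` of a vector bundle `E → S` -/

section BFV

variable (EB : Type*) [NormedAddCommGroup EB] [NormedSpace ℝ EB]
  {S : Type*} [TopologicalSpace S] [ChartedSpace EB S]
  (F : Type*) [NormedAddCommGroup F] [NormedSpace ℝ F]
  (V : S → Type*) [∀ x, AddCommGroup (V x)] [∀ x, Module ℝ (V x)]
  [TopologicalSpace (TotalSpace F V)] [∀ x, TopologicalSpace (V x)]
  [FiberBundle F V] [VectorBundle ℝ F V]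

/-- Let `𝓔 → E` be the pullback of `E → S` to the total space of `E`. A section of
`⋀𝓔 ⊗ ⋀𝓔* → E` is smooth if it is smooth in the local trivializations induced by those of `E`;
a map to the finite dimensional space `⋀(F ⊕ F*)` is smooth if its composition with every linear
form is. -/
def IsSmoothGhostSection (X : ∀ v : TotalSpace F V, GhostAlgebra (V v.proj)) : Prop :=
  ∀ (v₀ : TotalSpace F V) (φ : Module.Dual ℝ (GhostAlgebra F)),
    ContMDiffAt (𝓘(ℝ, EB).prod 𝓘(ℝ, F)) 𝓘(ℝ, ℝ) ∞
      (fun v : TotalSpace F V =>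
        φ (ghostMap ((trivializationAt F V v₀.proj).linearMapAt ℝ v.proj)
          ((trivializationAt F V v₀.proj).symmₗ ℝ v.proj) (X v))) v₀

variable {EB F V}

theorem IsSmoothGhostSection.add {X Y : ∀ v : TotalSpace F V, GhostAlgebra (V v.proj)}
    (hX : IsSmoothGhostSection EB F V X) (hY : IsSmoothGhostSection EB F V Y) :
    IsSmoothGhostSection EB F V (X + Y) := by
  intro v₀ φ
  simp only [Pi.add_apply, map_add]
  exact (hX v₀ φ).add (hY v₀ φ)

theorem IsSmoothGhostSection.mul [FiniteDimensional ℝ F]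
    {X Y : ∀ v : TotalSpace F V, GhostAlgebra (V v.proj)}
    (hX : IsSmoothGhostSection EB F V X) (hY : IsSmoothGhostSection EB F V Y) :
    IsSmoothGhostSection EB F V (X * Y) := by
  intro v₀ φ
  let b := Module.finBasis ℝ (GhostAlgebra F)
  simp only [Pi.mul_apply, map_mul]
  refine ContMDiffAt.congr_of_eventuallyEq ?_
    (Filter.Eventually.of_forall fun v => linearForm_mul_eq_sum b φ _ _)
  refine ContMDiffAt.sum fun i _ => ContMDiffAt.sum fun j _ => ?_
  exact ((hX v₀ (b.coord i)).mul (hY v₀ (b.coord j))).mul contMDiffAt_const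

theorem isSmoothGhostSection_algebraMap {f : TotalSpace F V → ℝ}
    (hf : ContMDiff (𝓘(ℝ, EB).prod 𝓘(ℝ, F)) 𝓘(ℝ, ℝ) ∞ f) :
    IsSmoothGhostSection EB F V (fun v => algebraMap ℝ (GhostAlgebra (V v.proj)) (f v)) := by
  intro v₀ φ
  have : (fun v : TotalSpace F V =>
        φ (ghostMap ((trivializationAt F V v₀.proj).linearMapAt ℝ v.proj)
          ((trivializationAt F V v₀.proj).symmₗ ℝ v.proj)
          (algebraMap ℝ (GhostAlgebra (V v.proj)) (f v)))) = fun v => f v * φ 1 := by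
    funext v
    rw [AlgHom.commutes, Algebra.algebraMap_eq_smul_one, map_smul, smul_eq_mul]
  rw [this]
  exact (hf v₀).mul contMDiffAt_const

/-- The tautological section `v ↦ v` of `𝓔 → E`, seen as a section of `⋀𝓔 ⊗ ⋀𝓔*`. -/
noncomputable def tautologicalFun (v : TotalSpace F V) : GhostAlgebra (V v.proj) :=
  ghost v.snd

theorem isSmoothGhostSection_tautological [FiniteDimensional ℝ F] :
    IsSmoothGhostSection EB F V (tautologicalFun (F := F) (V := V)) := by
  intro v₀ φ
  set e := trivializationAt F V v₀.proj with he
  have hsmooth : ContMDiffAt (𝓘(ℝ, EB).prod 𝓘(ℝ, F)) 𝓘(ℝ, F) ∞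
      (fun v : TotalSpace F V => (e v).2) v₀ := by
    have h : ContMDiffAt (𝓘(ℝ, EB).prod 𝓘(ℝ, F)) (𝓘(ℝ, EB).prod 𝓘(ℝ, F)) ∞
        (id : TotalSpace F V → TotalSpace F V) v₀ := contMDiffAt_id
    rw [contMDiffAt_totalSpace] at h
    exact h.2
  have hlin : ContMDiff 𝓘(ℝ, F) 𝓘(ℝ, ℝ) ∞ (fun w : F => φ (ghost w)) :=
    (LinearMap.toContinuousLinearMap (φ ∘ₗ (ghost : F →ₗ[ℝ] GhostAlgebra F))).contMDiff
  refine ((hlin.contMDiffAt (x := (e v₀).2)).comp v₀ hsmooth).congr_of_eventuallyEq ?_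
  have hnhds : e.source ∈ nhds v₀ :=
    e.open_source.mem_nhds (e.mem_source.2 (mem_baseSet_trivializationAt F V v₀.proj))
  filter_upwards [hnhds] with v hv
  have hb : v.proj ∈ e.baseSet := e.mem_source.1 hv
  have hlm : e.linearMapAt ℝ v.proj v.snd = (e v).2 := by
    rw [e.coe_linearMapAt_of_mem hb]
  simp only [Function.comp_apply, ← hlm]
  simp [tautologicalFun, ghostMap, ghost, he]

variable (EB F V)

/-- `BFV(E)`: the algebra of smooth sections of `⋀𝓔 ⊗ ⋀𝓔*` over the total space of `E`. -/
def BFV [FiniteDimensional ℝ F] :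
    Subalgebra ℝ (∀ v : TotalSpace F V, GhostAlgebra (V v.proj)) where
  carrier := {X | IsSmoothGhostSection EB F V X}
  mul_mem' hX hY := hX.mul hY
  add_mem' hX hY := hX.add hY
  algebraMap_mem' r := isSmoothGhostSection_algebraMap (f := fun _ => r) contMDiff_const

variable [FiniteDimensional ℝ F]

/-- The component of ghost degree `p` and ghost-momentum degree `q`: smooth sections of
`⋀^p 𝓔 ⊗ ⋀^q 𝓔*`. -/
def bfvBidegree (p q : ℕ) : Submodule ℝ (BFV EB F V) where
  carrier := {X | ∀ v, X.1 v ∈ ghostBidegree (V v.proj) p q}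
  add_mem' hX hY v := add_mem (hX v) (hY v)
  zero_mem' _ := zero_mem _
  smul_mem' r _ hX v := Submodule.smul_mem _ r (hX v)

/-- The component of total degree `k`: the (direct) sum of the components of bidegree `(p, q)`
with `p - q = k`. -/
def bfvDegree (k : ℤ) : Submodule ℝ (BFV EB F V) :=
  ⨆ (p : ℕ) (q : ℕ) (_ : (p : ℤ) - (q : ℤ) = k), bfvBidegree EB F V p q

/-- The smooth sections of `⋀𝓔 ⊗ ⋀^{≥ r} 𝓔*`. -/
def bfvGE (r : ℕ) : Submodule ℝ (BFV EB F V) where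
  carrier := {X | ∀ v, X.1 v ∈ ghostGE (V v.proj) r}
  add_mem' hX hY v := add_mem (hX v) (hY v)
  zero_mem' _ := zero_mem _
  smul_mem' s _ hX v := Submodule.smul_mem _ s (hX v)

variable {EB F V}

/-- The inclusion `C^∞(E) → BFV(E)` as functions that are constant along the fibres of
`𝓔*[1] ⊕ 𝓔[-1] → E`. -/
noncomputable def bfvOfFun (f : C^∞⟮𝓘(ℝ, EB).prod 𝓘(ℝ, F), TotalSpace F V; 𝓘(ℝ, ℝ), ℝ⟯) :
    BFV EB F V :=
  ⟨fun v => algebraMap ℝ (GhostAlgebra (V v.proj)) (f v),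
    isSmoothGhostSection_algebraMap f.contMDiff⟩

/-- The component in bidegree `(0, 0)` of an element of `BFV(E)`, as a function on `E`. It is the
restriction to the zero section of `𝓔*[1] ⊕ 𝓔[-1] → E`. -/
noncomputable def bfvToFun (X : BFV EB F V) (v : TotalSpace F V) : ℝ :=
  ExteriorAlgebra.algebraMapInv (X.1 v)

variable (EB F V) in
/-- The tautological section of `𝓔 → E` as an element of `BFV(E)`. -/
noncomputable def bfvTautological : BFV EB F V :=
  ⟨tautologicalFun, isSmoothGhostSection_tautological⟩

/-- A BFV bracket for the Poisson structure `P` on the total space of `E`: a graded Poisson bracket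
on `BFV(E)` that induces the Poisson bracket of `P` on functions on `E`, and whose component
`BFV^{(1,0)} ⊗ BFV^{(0,1)} → BFV^{(0,0)}` is the fibre pairing between `𝓔` and `𝓔*`. -/
structure IsBFVBracket (P : PoissonStructure (𝓘(ℝ, EB).prod 𝓘(ℝ, F)) (TotalSpace F V))
    (br : BFV EB F V →ₗ[ℝ] BFV EB F V →ₗ[ℝ] BFV EB F V) : Prop where
  isGradedPoisson : IsGradedPoissonBracket (bfvDegree EB F V) br
  base : ∀ (f g : C^∞⟮𝓘(ℝ, EB).prod 𝓘(ℝ, F), TotalSpace F V; 𝓘(ℝ, ℝ), ℝ⟯) (v : TotalSpace F V),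
    bfvToFun (br (bfvOfFun f) (bfvOfFun g)) v = P.bracket f g v
  pairing : ∀ (X Y : BFV EB F V) (a : ∀ v : TotalSpace F V, V v.proj)
    (α : ∀ v : TotalSpace F V, Module.Dual ℝ (V v.proj)),
    (∀ v, X.1 v = ghost (a v)) → (∀ v, Y.1 v = ghostMomentum (α v)) →
      ∀ v, bfvToFun (br X Y) v = α v (a v)

end BFV

/-! The charge is built by homological perturbation along the filtration by ghost-momentum degree
`q`. Write δ for fibrewise contraction with the tautological section, a Koszul differential lowering
`q` by one.

Two facts carry the argument. First, for Ω of degree 1 with Ω ≡ Ω₀ modulo `BFV_{≥ 1}`, the operator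
`[Ω, -] - δ` preserves the filtration (`IsBFVBracket.bracket_sub_ghostContract_mem`). No formula for
the bracket is available: at a point of `E`, the operator is a graded derivation, so with cutoff
functions it is enough to look at ghost momenta (`IsPointDerivation.mem_ghostGE`), where degree
reasons and the pairing axiom decide. Second, δ is exact: a closed section of bidegree `(p, q)` is δ
of one of bidegree `(p, q + 1)`, provided that for `q = 0` it vanishes on the zero section
(`exists_koszul_primitive`). The primitive is a weighted radial integral along the fibres, glued by
a partition of unity on `S`.

Suppose `[Ω, Ω]` lies in `BFV_{≥ r}`, with leading component `R` of bidegree `(r + 2, r)`. The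
Jacobi identity gives `[Ω, [Ω, Ω]] = 0`, hence `δR = 0`; writing `R = δY`, the element `Ω - Y/2`
squares to zero modulo `BFV_{≥ r + 1}` (`IsBFVBracket.exists_correction`). For `r = 0` closedness is
automatic, and the needed vanishing of `R` on `S` is coisotropy: fibre coordinates vanish on `S`,
hence Poisson commute there, and near each point of `S` the tautological section is a combination of
them (`IsBFVBracket.tautological_bracket_mem`). The process stops because `⋀^q 𝓔* = 0` for `q` above
the rank. -/

set_option linter.unusedSectionVars false

/-! ### Bigraded linear algebra of the fibre `⋀(W ⊕ W*)` -/

section GhostAlgebraLemmas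

variable {W W' W'' : Type*} [AddCommGroup W] [Module ℝ W] [AddCommGroup W'] [Module ℝ W']
  [AddCommGroup W''] [Module ℝ W'']

theorem ghost_apply (a : W) : ghost a = ExteriorAlgebra.ι ℝ (a, (0 : Module.Dual ℝ W)) := rfl

theorem ghostMomentum_apply (β : Module.Dual ℝ W) :
    ghostMomentum β = ExteriorAlgebra.ι ℝ ((0 : W), β) := rfl

theorem ι_eq_ghost_add_ghostMomentum (m : W × Module.Dual ℝ W) :
    ExteriorAlgebra.ι ℝ m = ghost m.1 + ghostMomentum m.2 := by
  rw [ghost_apply, ghostMomentum_apply, ← map_add]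
  simp

/-! #### Multiplicativity of the bigrading -/

/-- Elements of `W` and `W*` anticommute, but a subspace absorbs the sign, so the two ranges commute
exactly. This makes the bidegree multiplicative. -/
theorem commute_range_ghost_range_ghostMomentum :
    Commute (LinearMap.range (ghost (W := W))) (LinearMap.range (ghostMomentum (W := W))) := by
  have key : ∀ x y : W × Module.Dual ℝ W,
      ExteriorAlgebra.ι ℝ x * ExteriorAlgebra.ι ℝ y =
        ExteriorAlgebra.ι ℝ (-y) * ExteriorAlgebra.ι ℝ x := fun x y => by
    rw [map_neg, neg_mul, eq_neg_iff_add_eq_zero, ExteriorAlgebra.ι_add_mul_swap]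
  apply le_antisymm
  · rw [Submodule.mul_le]
    rintro _ ⟨a, rfl⟩ _ ⟨β, rfl⟩
    rw [ghost_apply, ghostMomentum_apply, key]
    refine Submodule.mul_mem_mul ⟨-β, ?_⟩ ⟨a, rfl⟩
    rw [ghostMomentum_apply]; simp
  · rw [Submodule.mul_le]
    rintro _ ⟨β, rfl⟩ _ ⟨a, rfl⟩
    rw [ghost_apply, ghostMomentum_apply, key]
    refine Submodule.mul_mem_mul ⟨-a, ?_⟩ ⟨β, rfl⟩
    rw [ghost_apply]; simp

theorem ghostBidegree_mul (p q p' q' : ℕ) :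
    ghostBidegree W p q * ghostBidegree W p' q' = ghostBidegree W (p + p') (q + q') := by
  unfold ghostBidegree
  have h := (commute_range_ghost_range_ghostMomentum (W := W)).symm.pow_pow q p'
  rw [pow_add, pow_add, mul_assoc, ← mul_assoc (_ ^ q), h.eq]
  simp only [mul_assoc]

theorem mul_mem_ghostBidegree {p q p' q' : ℕ} {x y : GhostAlgebra W}
    (hx : x ∈ ghostBidegree W p q) (hy : y ∈ ghostBidegree W p' q') :
    x * y ∈ ghostBidegree W (p + p') (q + q') :=
  (ghostBidegree_mul (W := W) p q p' q').le (Submodule.mul_mem_mul hx hy)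

theorem ghostBidegree_zero_zero : ghostBidegree W 0 0 = 1 := by
  simp [ghostBidegree]

theorem algebraMap_mem_ghostBidegree (r : ℝ) :
    algebraMap ℝ (GhostAlgebra W) r ∈ ghostBidegree W 0 0 := by
  rw [ghostBidegree_zero_zero]
  exact Submodule.algebraMap_mem (A := GhostAlgebra W) r

theorem ghost_mem_ghostBidegree (a : W) : ghost a ∈ ghostBidegree W 1 0 := by
  simp [ghostBidegree]

theorem ghostMomentum_mem_ghostBidegree (β : Module.Dual ℝ W) :
    ghostMomentum β ∈ ghostBidegree W 0 1 := by
  simp [ghostBidegree]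

theorem ghostBidegree_le_ghostGE {p q r : ℕ} (h : r ≤ q) : ghostBidegree W p q ≤ ghostGE W r :=
  le_iSup_of_le p (le_iSup_of_le q (le_iSup_of_le h le_rfl))

theorem ghostGE_antitone {r s : ℕ} (h : r ≤ s) : ghostGE W s ≤ ghostGE W r :=
  iSup_le fun _ => iSup_le fun _ => iSup_le fun hq => ghostBidegree_le_ghostGE (h.trans hq)

theorem mul_mem_ghostGE {r s : ℕ} {x y : GhostAlgebra W} (hx : x ∈ ghostGE W r)
    (hy : y ∈ ghostGE W s) : x * y ∈ ghostGE W (r + s) := by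
  have h : ghostGE W r * ghostGE W s ≤ ghostGE W (r + s) := by
    simp only [ghostGE, Submodule.iSup_mul, Submodule.mul_iSup, iSup_le_iff]
    intro p' q' hq' p q hq
    rw [ghostBidegree_mul]
    exact ghostBidegree_le_ghostGE (by omega)
  exact h (Submodule.mul_mem_mul hx hy)

theorem mem_ghostGE_zero (x : GhostAlgebra W) : x ∈ ghostGE W 0 := by
  induction x using ExteriorAlgebra.induction with
  | algebraMap r => exact ghostBidegree_le_ghostGE le_rfl (algebraMap_mem_ghostBidegree r)
  | ι m =>
    rw [ι_eq_ghost_add_ghostMomentum]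
    exact add_mem (ghostBidegree_le_ghostGE le_rfl (ghost_mem_ghostBidegree _))
      (ghostBidegree_le_ghostGE (Nat.zero_le _) (ghostMomentum_mem_ghostBidegree _))
  | mul a b ha hb => simpa only [add_zero] using mul_mem_ghostGE ha hb
  | add a b ha hb => exact add_mem ha hb

theorem mul_mem_ghostGE_left {r : ℕ} {x : GhostAlgebra W} (hx : x ∈ ghostGE W r)
    (y : GhostAlgebra W) : x * y ∈ ghostGE W r := by
  simpa only [add_zero] using mul_mem_ghostGE hx (mem_ghostGE_zero y)

theorem mul_mem_ghostGE_right {r : ℕ} (x : GhostAlgebra W) {y : GhostAlgebra W}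
    (hy : y ∈ ghostGE W r) : x * y ∈ ghostGE W r := by
  simpa only [zero_add] using mul_mem_ghostGE (mem_ghostGE_zero x) hy

/-- A linear condition holds on `⋀^p W ⊗ ⋀^q W*` as soon as it holds on scalars and propagates
under left multiplication by generators. -/
theorem ghostBidegree_induction {C : ℕ → ℕ → GhostAlgebra W → Prop}
    (one : ∀ r : ℝ, C 0 0 (algebraMap ℝ _ r))
    (add : ∀ {p q : ℕ} x y, C p q x → C p q y → C p q (x + y))
    (momentum : ∀ q β x, x ∈ ghostBidegree W 0 q → C 0 q x → C 0 (q + 1) (ghostMomentum β * x))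
    (ghost : ∀ p q a x, x ∈ ghostBidegree W p q → C p q x → C (p + 1) q (ghost a * x))
    {p q : ℕ} {x : GhostAlgebra W} (hx : x ∈ ghostBidegree W p q) : C p q x := by
  have h0 : ∀ q x, x ∈ LinearMap.range (ghostMomentum (W := W)) ^ q → C 0 q x := by
    intro q
    induction q with
    | zero =>
      intro x hx
      rw [pow_zero, Submodule.mem_one] at hx
      obtain ⟨r, rfl⟩ := hx
      exact one r
    | succ q ih =>
      intro x hx
      rw [pow_succ'] at hx
      induction hx using Submodule.mul_induction_on' with
      | mem_mul_mem m hm n hn =>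
        obtain ⟨β, rfl⟩ := hm
        exact momentum q β n (by simpa [ghostBidegree] using hn) (ih n hn)
      | add x _ y _ hx hy => exact add _ _ hx hy
  induction p generalizing x with
  | zero => exact h0 q x (by simpa [ghostBidegree] using hx)
  | succ p ih =>
    rw [ghostBidegree, pow_succ', mul_assoc] at hx
    induction hx using Submodule.mul_induction_on' with
    | mem_mul_mem m hm n hn =>
      obtain ⟨a, rfl⟩ := hm
      exact ghost p q a n hn (ih hn)
    | add x _ y _ hx hy => exact add _ _ hx hy

theorem ghostAlgebra_left_induction {C : GhostAlgebra W → Prop}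
    (algebraMap : ∀ r : ℝ, C (algebraMap ℝ _ r)) (add : ∀ x y, C x → C y → C (x + y))
    (ι_mul : ∀ m x, C x → C (ExteriorAlgebra.ι ℝ m * x)) (x : GhostAlgebra W) : C x :=
  CliffordAlgebra.left_induction (Q := 0) (P := C) algebraMap add (fun x m h => ι_mul m x h) x

variable (W) in
/-- The parity involution of `⋀(W ⊕ W*)`. -/
noncomputable def ghostInvolute : GhostAlgebra W →ₐ[ℝ] GhostAlgebra W :=
  ExteriorAlgebra.map (-LinearMap.id)

@[simp] theorem ghostInvolute_ι (m : W × Module.Dual ℝ W) :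
    ghostInvolute W (ExteriorAlgebra.ι ℝ m) = -ExteriorAlgebra.ι ℝ m := by
  rw [ghostInvolute, ExteriorAlgebra.map_apply_ι]
  simp

theorem ghostInvolute_of_mem_ghostBidegree {p q : ℕ} {x : GhostAlgebra W}
    (hx : x ∈ ghostBidegree W p q) : ghostInvolute W x = (-1 : ℝ) ^ (p + q) • x := by
  refine ghostBidegree_induction (C := fun p q x =>
    ghostInvolute W x = (-1 : ℝ) ^ (p + q) • x) ?_ ?_ ?_ ?_ hx
  · intro r; simp
  · intro p q x y hx hy; rw [map_add, hx, hy, smul_add]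
  · intro q β x _ hx
    rw [map_mul, hx, ghostMomentum_apply]
    rw [ghostInvolute_ι, ← add_assoc, pow_succ, mul_neg_one, neg_smul, neg_mul, mul_smul_comm]
  · intro p q a x _ hx
    rw [map_mul, hx, ghost_apply]
    rw [ghostInvolute_ι, add_right_comm, pow_succ, mul_neg_one, neg_smul, neg_mul, mul_smul_comm]

/-- In bidegree other than `(0, 0)` there is no scalar component. -/
theorem algebraMapInv_of_mem_ghostBidegree {p q : ℕ} (h : p + q ≠ 0) {x : GhostAlgebra W}
    (hx : x ∈ ghostBidegree W p q) : ExteriorAlgebra.algebraMapInv x = 0 := by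
  refine ghostBidegree_induction (C := fun p q x =>
    p + q ≠ 0 → ExteriorAlgebra.algebraMapInv x = 0) ?_ ?_ ?_ ?_ hx h
  · intro r h; exact absurd rfl h
  · intro p q x y hx hy h; rw [map_add, hx h, hy h, add_zero]
  · intro q β x _ _ _
    rw [map_mul, ghostMomentum_apply]
    simp [ExteriorAlgebra.algebraMapInv]
  · intro p q a x _ _ _
    rw [map_mul, ghost_apply]
    simp [ExteriorAlgebra.algebraMapInv]

/-! #### Functoriality -/

@[simp] theorem ghostMap_ghost (A : W →ₗ[ℝ] W') (B : W' →ₗ[ℝ] W) (a : W) :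
    ghostMap A B (ghost a) = ghost (A a) := by
  simp [ghostMap, ghost_apply]

@[simp] theorem ghostMap_ghostMomentum (A : W →ₗ[ℝ] W') (B : W' →ₗ[ℝ] W) (β : Module.Dual ℝ W) :
    ghostMap A B (ghostMomentum β) = ghostMomentum (β ∘ₗ B) := by
  simp [ghostMap, ghostMomentum_apply]
  rfl

theorem ghostMap_ghostMap (A : W →ₗ[ℝ] W') (B : W' →ₗ[ℝ] W) (A' : W' →ₗ[ℝ] W'')
    (B' : W'' →ₗ[ℝ] W') (x : GhostAlgebra W) :
    ghostMap A' B' (ghostMap A B x) = ghostMap (A' ∘ₗ A) (B ∘ₗ B') x := by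
  unfold ghostMap
  rw [← AlgHom.comp_apply, ExteriorAlgebra.map_comp_map]
  rfl

theorem ghostMap_id (x : GhostAlgebra W) : ghostMap LinearMap.id LinearMap.id x = x := by
  have : (LinearMap.id (R := ℝ) (M := W)).prodMap (LinearMap.id (R := ℝ) (M := W)).dualMap =
      LinearMap.id := by
    ext <;> rfl
  rw [ghostMap, this, ExteriorAlgebra.map_id, AlgHom.id_apply]

theorem ghostMap_ghostMap_of_leftInverse {A : W →ₗ[ℝ] W'} {B : W' →ₗ[ℝ] W}
    (h : B ∘ₗ A = LinearMap.id) (x : GhostAlgebra W) : ghostMap B A (ghostMap A B x) = x := by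
  rw [ghostMap_ghostMap, h, ghostMap_id]

theorem ghostMap_mem_ghostBidegree (A : W →ₗ[ℝ] W') (B : W' →ₗ[ℝ] W) {p q : ℕ}
    {x : GhostAlgebra W} (hx : x ∈ ghostBidegree W p q) :
    ghostMap A B x ∈ ghostBidegree W' p q := by
  refine ghostBidegree_induction (C := fun p q x => ghostMap A B x ∈ ghostBidegree W' p q)
    ?_ ?_ ?_ ?_ hx
  · intro r; rw [AlgHom.commutes]; exact algebraMap_mem_ghostBidegree r
  · intro p q x y hx hy; rw [map_add]; exact add_mem hx hy
  · intro q β x _ hx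
    rw [map_mul, ghostMap_ghostMomentum]
    simpa [add_comm] using mul_mem_ghostBidegree (ghostMomentum_mem_ghostBidegree _) hx
  · intro p q a x _ hx
    rw [map_mul, ghostMap_ghost]
    simpa [add_comm] using mul_mem_ghostBidegree (ghost_mem_ghostBidegree _) hx

theorem ghostMap_mem_ghostGE (A : W →ₗ[ℝ] W') (B : W' →ₗ[ℝ] W) {r : ℕ}
    {x : GhostAlgebra W} (hx : x ∈ ghostGE W r) : ghostMap A B x ∈ ghostGE W' r := by
  have : ghostGE W r ≤ (ghostGE W' r).comap (ghostMap A B).toLinearMap :=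
    iSup_le fun p => iSup_le fun q => iSup_le fun hq x hx =>
      ghostBidegree_le_ghostGE hq (ghostMap_mem_ghostBidegree A B hx)
  exact this hx

/-! #### Contraction with a vector -/

/-- Contraction of `⋀(W ⊕ W*)` with a vector of `W`, paired with the summand `W*`. -/
noncomputable def ghostContract : W →ₗ[ℝ] GhostAlgebra W →ₗ[ℝ] GhostAlgebra W :=
  CliffordAlgebra.contractLeft ∘ₗ (LinearMap.snd ℝ W (Module.Dual ℝ W)).dualMap ∘ₗ
    Module.Dual.eval ℝ W

theorem ghostContract_ι_mul (w : W) (m : W × Module.Dual ℝ W) (x : GhostAlgebra W) :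
    ghostContract w (ExteriorAlgebra.ι ℝ m * x) =
      m.2 w • x - ExteriorAlgebra.ι ℝ m * ghostContract w x :=
  CliffordAlgebra.contractLeft_ι_mul (Q := 0) _ _ _

theorem ghostContract_algebraMap (w : W) (r : ℝ) :
    ghostContract w (algebraMap ℝ (GhostAlgebra W) r) = 0 :=
  CliffordAlgebra.contractLeft_algebraMap (Q := 0) _ _

theorem ghostContract_ghostMomentum_mul (w : W) (β : Module.Dual ℝ W) (x : GhostAlgebra W) :
    ghostContract w (ghostMomentum β * x) = β w • x - ghostMomentum β * ghostContract w x :=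
  ghostContract_ι_mul w (0, β) x

theorem ghostContract_ghost_mul (w a : W) (x : GhostAlgebra W) :
    ghostContract w (ghost a * x) = -(ghost a * ghostContract w x) := by
  rw [ghost_apply, ghostContract_ι_mul]
  simp

theorem ghostContract_ghostMomentum (w : W) (β : Module.Dual ℝ W) :
    ghostContract w (ghostMomentum β) = algebraMap ℝ _ (β w) := by
  have := ghostContract_ghostMomentum_mul w β 1
  rw [← map_one (algebraMap ℝ (GhostAlgebra W)), ghostContract_algebraMap, map_one, mul_one,
    mul_zero, sub_zero] at this
  rw [this, Algebra.algebraMap_eq_smul_one]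

/-- The graded Leibniz rule, with the parity involution carrying the sign. It allows contraction to
be compared with the bracket as a derivation. -/
theorem ghostContract_mul (w : W) (x y : GhostAlgebra W) :
    ghostContract w (x * y) =
      ghostContract w x * y + ghostInvolute W x * ghostContract w y := by
  induction x using ghostAlgebra_left_induction with
  | algebraMap r =>
    rw [ghostContract_algebraMap, zero_mul, zero_add, AlgHom.commutes, ← Algebra.smul_def,
      ← Algebra.smul_def, map_smul]
  | add a b ha hb => rw [add_mul, map_add, map_add, map_add, ha, hb]; noncomm_ring
  | ι_mul m x hx =>
    rw [mul_assoc, ghostContract_ι_mul, ghostContract_ι_mul, hx, map_mul, ghostInvolute_ι, sub_mul,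
      smul_mul_assoc, mul_add]
    noncomm_ring

/-- The condition on `A` and `B` preserves the pairing: `β ∘ B` takes the same value at `A w` as `β`
at `w`. -/
theorem ghostMap_ghostContract {A : W →ₗ[ℝ] W'} {B : W' →ₗ[ℝ] W} (h : B ∘ₗ A = LinearMap.id)
    (w : W) (x : GhostAlgebra W) :
    ghostMap A B (ghostContract w x) = ghostContract (A w) (ghostMap A B x) := by
  induction x using ghostAlgebra_left_induction with
  | algebraMap r =>
    rw [ghostContract_algebraMap, AlgHom.commutes, ghostContract_algebraMap, map_zero]
  | add a b ha hb => rw [map_add, map_add, map_add, map_add, ha, hb]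
  | ι_mul m x hx =>
    have h' : B (A w) = w := LinearMap.congr_fun h w
    have e1 : ghostMap A B (ExteriorAlgebra.ι ℝ m) =
      ExteriorAlgebra.ι ℝ (A.prodMap B.dualMap m) := ExteriorAlgebra.map_apply_ι _ _
    rw [ghostContract_ι_mul, map_sub, map_mul, map_mul, map_smul, e1, ghostContract_ι_mul, hx]
    simp [h']

theorem ghostContract_of_mem_ghostBidegree_zero (w : W) {p : ℕ} {x : GhostAlgebra W}
    (hx : x ∈ ghostBidegree W p 0) : ghostContract w x = 0 := by
  refine ghostBidegree_induction (C := fun p q x => q = 0 → ghostContract w x = 0)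
    ?_ ?_ ?_ ?_ hx rfl
  · intro r _; exact ghostContract_algebraMap w r
  · intro p q x y hx hy h; rw [map_add, hx h, hy h, add_zero]
  · intro q β x _ _ h; omega
  · intro p q a x _ hx h; rw [ghostContract_ghost_mul, hx h, mul_zero, neg_zero]

theorem ghostContract_mem_ghostBidegree (w : W) {p q : ℕ} {x : GhostAlgebra W}
    (hx : x ∈ ghostBidegree W p (q + 1)) : ghostContract w x ∈ ghostBidegree W p q := by
  refine ghostBidegree_induction (C := fun p q' x => ∀ q, q' = q + 1 →
    ghostContract w x ∈ ghostBidegree W p q) ?_ ?_ ?_ ?_ hx q rfl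
  · intro r q h; omega
  · intro p q x y hx hy q' h; rw [map_add]; exact add_mem (hx q' h) (hy q' h)
  · intro q' β x hx hx' q h
    obtain rfl : q' = q := by omega
    rw [ghostContract_ghostMomentum_mul]
    refine sub_mem (Submodule.smul_mem _ _ hx) ?_
    -- Without a momentum in `x` the second term vanishes, so the missing degree `q - 1` never
    -- arises.
    rcases q' with _ | q
    · rw [ghostContract_of_mem_ghostBidegree_zero w hx, mul_zero]; exact zero_mem _
    · simpa [add_comm] using
        mul_mem_ghostBidegree (ghostMomentum_mem_ghostBidegree β) (hx' q rfl)
  · intro p q' a x _ hx q h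
    rw [ghostContract_ghost_mul]
    refine neg_mem ?_
    simpa [add_comm] using mul_mem_ghostBidegree (ghost_mem_ghostBidegree a) (hx q h)

theorem ghostContract_mem_ghostGE (w : W) {r : ℕ} {x : GhostAlgebra W}
    (hx : x ∈ ghostGE W (r + 1)) : ghostContract w x ∈ ghostGE W r := by
  have : ghostGE W (r + 1) ≤ (ghostGE W r).comap (ghostContract w) :=
    iSup_le fun p => iSup_le fun q => iSup_le fun hq x hx => by
      obtain ⟨q, rfl⟩ : ∃ q', q = q' + 1 := ⟨q - 1, by omega⟩
      exact ghostBidegree_le_ghostGE (by omega) (ghostContract_mem_ghostBidegree w hx)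
  exact this hx

/-- The operator `∑ eⁱ ∧ ι_{e_i}` counts the ghost momenta. -/
theorem sum_ghostMomentum_mul_ghostContract {ι : Type*} [Fintype ι] (b : Module.Basis ι ℝ W)
    {p q : ℕ} {x : GhostAlgebra W} (hx : x ∈ ghostBidegree W p q) :
    ∑ i, ghostMomentum (b.coord i) * ghostContract (b i) x = (q : ℝ) • x := by
  have anti : ∀ y z : W × Module.Dual ℝ W, ∀ u : GhostAlgebra W,
      ExteriorAlgebra.ι ℝ y * (ExteriorAlgebra.ι ℝ z * u) =
        -(ExteriorAlgebra.ι ℝ z * (ExteriorAlgebra.ι ℝ y * u)) := fun y z u => by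
    rw [← mul_assoc, ← mul_assoc, eq_neg_iff_add_eq_zero, ← add_mul,
      ExteriorAlgebra.ι_add_mul_swap, zero_mul]
  refine ghostBidegree_induction (C := fun p q x =>
    ∑ i, ghostMomentum (b.coord i) * ghostContract (b i) x = (q : ℝ) • x) ?_ ?_ ?_ ?_ hx
  · intro r; simp [ghostContract_algebraMap]
  · intro p q x y hx hy
    simp only [map_add, mul_add, Finset.sum_add_distrib, hx, hy, smul_add]
  · intro q β x _ hx
    have hβ : ∑ i, β (b i) • ghostMomentum (b.coord i) = ghostMomentum β := by
      simp only [← map_smul, ← map_sum]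
      congr 1
      refine b.ext fun j => ?_
      simp
    calc _ = (∑ i, β (b i) • ghostMomentum (b.coord i)) * x
          + ghostMomentum β * ∑ i, ghostMomentum (b.coord i) * ghostContract (b i) x := by
            rw [Finset.sum_mul, Finset.mul_sum, ← Finset.sum_add_distrib]
            refine Finset.sum_congr rfl fun i _ => ?_
            rw [ghostContract_ghostMomentum_mul, mul_sub, mul_smul_comm, smul_mul_assoc,
              sub_eq_add_neg]
            congr 1
            rw [ghostMomentum_apply, ghostMomentum_apply, anti, neg_neg]
      _ = _ := by
            rw [hβ, hx, mul_smul_comm]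
            push_cast
            rw [add_smul, one_smul, add_comm]
  · intro p q a x _ hx
    calc _ = ghost a * ∑ i, ghostMomentum (b.coord i) * ghostContract (b i) x := by
            rw [Finset.mul_sum]
            refine Finset.sum_congr rfl fun i _ => ?_
            rw [ghostContract_ghost_mul, mul_neg, ghostMomentum_apply, ghost_apply, anti, neg_neg]
      _ = _ := by rw [hx, mul_smul_comm]

/-! #### Independence of the components -/

variable (W) in
/-- The span of all components of ghost-momentum degree different from `q`. -/
noncomputable def ghostNe (q : ℕ) : Submodule ℝ (GhostAlgebra W) :=
  ⨆ (p' : ℕ) (q' : ℕ) (_ : q' ≠ q), ghostBidegree W p' q'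

theorem ghostGE_le_ghostNe {r q : ℕ} (h : q < r) : ghostGE W r ≤ ghostNe W q :=
  iSup_le fun p' => iSup_le fun q' => iSup_le fun hq =>
    le_iSup_of_le p' (le_iSup_of_le q' (le_iSup_of_le (by omega) le_rfl))

/-- The momentum degree is an eigenvalue of the counting operator `∑ eⁱ ∧ ι_{e_i}`, and eigenspaces
for distinct eigenvalues are independent; no explicit decomposition of the exterior algebra is
needed. -/
theorem eq_zero_of_mem_ghostNe [FiniteDimensional ℝ W] {q : ℕ} {x : GhostAlgebra W}
    (hx : x ∈ ⨆ p, ghostBidegree W p q) (hx' : x ∈ ghostNe W q) : x = 0 := by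
  let b := Module.finBasis ℝ W
  let N : Module.End ℝ (GhostAlgebra W) :=
    ∑ i, LinearMap.mulLeft ℝ (ghostMomentum (b.coord i)) ∘ₗ ghostContract (b i)
  have hN : ∀ p q, ghostBidegree W p q ≤ N.eigenspace (q : ℝ) := fun p q x hx => by
    rw [Module.End.mem_eigenspace_iff, ← sum_ghostMomentum_mul_ghostContract b hx]
    simp [N, LinearMap.sum_apply]
  have hind := N.eigenspaces_iSupIndep (q : ℝ)
  rw [Submodule.disjoint_def] at hind
  refine hind x (iSup_le (fun p => hN p q) hx) ?_
  refine (iSup_le fun p' => iSup_le fun q' => iSup_le fun hq => ?_ : ghostNe W q ≤ _) hx'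
  exact (hN p' q').trans (le_iSup_of_le (q' : ℝ) (le_iSup_of_le (by exact_mod_cast hq) le_rfl))

theorem eq_zero_of_mem_ghostBidegree_of_mem_ghostGE [FiniteDimensional ℝ W] {p q r : ℕ}
    (h : q < r) {x : GhostAlgebra W} (hx : x ∈ ghostBidegree W p q) (hx' : x ∈ ghostGE W r) :
    x = 0 :=
  eq_zero_of_mem_ghostNe (Submodule.mem_iSup_of_mem p hx) (ghostGE_le_ghostNe h hx')

/-- If `y` is the component of `x ∈ ⋀W ⊗ ⋀^{≥ r} W*` of ghost-momentum degree `r`, then `x - y` is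
in `⋀W ⊗ ⋀^{≥ r + 1} W*`. -/
theorem sub_mem_ghostGE_succ [FiniteDimensional ℝ W] {p r : ℕ} {x y : GhostAlgebra W}
    (hx : x ∈ ghostGE W r) (hy : y ∈ ghostBidegree W p r) (hxy : x - y ∈ ghostNe W r) :
    x - y ∈ ghostGE W (r + 1) := by
  have hle : ghostGE W r ≤ (⨆ p, ghostBidegree W p r) ⊔ ghostGE W (r + 1) := by
    refine iSup_le fun p' => iSup_le fun q' => iSup_le fun hq => ?_
    rcases hq.eq_or_lt with rfl | hq
    · exact le_sup_of_le_left (le_iSup (fun p => ghostBidegree W p r) p')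
    · exact le_sup_of_le_right (ghostBidegree_le_ghostGE hq)
  obtain ⟨u, hu, w, hw, rfl⟩ := Submodule.mem_sup.1 (hle hx)
  have : u - y = 0 := by
    refine eq_zero_of_mem_ghostNe (sub_mem hu (Submodule.mem_iSup_of_mem p hy)) ?_
    have := sub_mem hxy (ghostGE_le_ghostNe (Nat.lt_succ_self r) hw)
    rwa [show u + w - y - w = u - y by abel] at this
  rw [show u + w - y = w by rw [← sub_eq_zero.1 this]; abel]
  exact hw

/-- A product of `q` momenta comes from `⋀^q W*`, whose dimension is a binomial coefficient that
vanishes for `q` above `dim W`. -/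
theorem ghostGE_eq_bot [FiniteDimensional ℝ W] {r : ℕ} (h : Module.finrank ℝ W < r) :
    ghostGE W r = ⊥ := by
  have key : ∀ q, r ≤ q → LinearMap.range (ghostMomentum (W := W)) ^ q = ⊥ := by
    intro q hq
    have h1 : LinearMap.range (ghostMomentum (W := W)) =
        (LinearMap.range (ExteriorAlgebra.ι ℝ (M := Module.Dual ℝ W))).map
          (ExteriorAlgebra.map (LinearMap.inr ℝ W (Module.Dual ℝ W))).toLinearMap := by
      rw [← LinearMap.range_comp, ExteriorAlgebra.map_comp_ι]
      rfl
    have h2 : LinearMap.range (ExteriorAlgebra.ι ℝ (M := Module.Dual ℝ W)) ^ q = ⊥ := by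
      have : Module.finrank ℝ (⋀[ℝ]^q (Module.Dual ℝ W)) = 0 := by
        rw [exteriorPower.finrank_eq, Subspace.dual_finrank_eq]
        exact Nat.choose_eq_zero_of_lt (by omega)
      exact Submodule.finrank_eq_zero.1 this
    rw [h1, ← Submodule.map_pow, h2, Submodule.map_bot]
  rw [eq_bot_iff]
  refine iSup_le fun p => iSup_le fun q => iSup_le fun hq => ?_
  rw [ghostBidegree, key q hq, Submodule.mul_bot]

end GhostAlgebraLemmas

/-! ### Smoothness in trivializations, cutoffs and local frames -/

section LocalSections

variable {EB : Type*} [NormedAddCommGroup EB] [NormedSpace ℝ EB]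
  {S : Type*} [TopologicalSpace S] [ChartedSpace EB S]
  {F : Type*} [NormedAddCommGroup F] [NormedSpace ℝ F]
  {V : S → Type*} [∀ x, AddCommGroup (V x)] [∀ x, Module ℝ (V x)]
  [TopologicalSpace (TotalSpace F V)] [∀ x, TopologicalSpace (V x)]
  [FiberBundle F V] [VectorBundle ℝ F V]

variable (EB) in
/-- A function on `E` with values in `⋀(F ⊕ F*)` is smooth at a point if its composition with every
linear form is. -/
def IsSmoothGhostAt (c : TotalSpace F V → GhostAlgebra F) (v₀ : TotalSpace F V) : Prop :=
  ∀ φ : Module.Dual ℝ (GhostAlgebra F),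
    ContMDiffAt (𝓘(ℝ, EB).prod 𝓘(ℝ, F)) 𝓘(ℝ, ℝ) ∞ (fun v => φ (c v)) v₀

theorem IsSmoothGhostAt.congr {c c' : TotalSpace F V → GhostAlgebra F} {v₀ : TotalSpace F V}
    (h : IsSmoothGhostAt EB c v₀) (h' : c' =ᶠ[nhds v₀] c) : IsSmoothGhostAt EB c' v₀ := fun φ =>
  (h φ).congr_of_eventuallyEq (h'.fun_comp φ)

theorem isSmoothGhostAt_const (z : GhostAlgebra F) (v₀ : TotalSpace F V) :
    IsSmoothGhostAt EB (fun _ => z) v₀ := fun _ => contMDiffAt_const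

theorem IsSmoothGhostAt.smul {f : TotalSpace F V → ℝ} {c : TotalSpace F V → GhostAlgebra F}
    {v₀ : TotalSpace F V} (hf : ContMDiffAt (𝓘(ℝ, EB).prod 𝓘(ℝ, F)) 𝓘(ℝ, ℝ) ∞ f v₀)
    (hc : IsSmoothGhostAt EB c v₀) : IsSmoothGhostAt EB (fun v => f v • c v) v₀ := fun φ => by
  simp only [map_smul, smul_eq_mul]
  exact hf.mul (hc φ)

theorem IsSmoothGhostAt.sum {ι : Type*} {s : Finset ι} {c : ι → TotalSpace F V → GhostAlgebra F}
    {v₀ : TotalSpace F V} (hc : ∀ i ∈ s, IsSmoothGhostAt EB (c i) v₀) :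
    IsSmoothGhostAt EB (fun v => ∑ i ∈ s, c i v) v₀ := fun φ => by
  simp only [map_sum]
  exact ContMDiffAt.sum fun i hi => hc i hi φ

theorem IsSmoothGhostAt.mul [FiniteDimensional ℝ F] {c c' : TotalSpace F V → GhostAlgebra F}
    {v₀ : TotalSpace F V} (hc : IsSmoothGhostAt EB c v₀) (hc' : IsSmoothGhostAt EB c' v₀) :
    IsSmoothGhostAt EB (fun v => c v * c' v) v₀ := fun φ => by
  let b := Module.finBasis ℝ (GhostAlgebra F)
  refine ContMDiffAt.congr_of_eventuallyEq ?_
    (Filter.Eventually.of_forall fun v => linearForm_mul_eq_sum b φ _ _)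
  refine ContMDiffAt.sum fun i _ => ContMDiffAt.sum fun j _ => ?_
  exact ((hc (b.coord i)).mul (hc' (b.coord j))).mul contMDiffAt_const

variable (e e' : Trivialization F (π F V)) [MemTrivializationAtlas e] [MemTrivializationAtlas e']

theorem symmₗ_comp_linearMapAt {x : S} (hx : x ∈ e.baseSet) :
    e.symmₗ ℝ x ∘ₗ e.linearMapAt ℝ x = LinearMap.id :=
  LinearMap.ext (e.symmₗ_linearMapAt hx)

theorem linearMapAt_comp_symmₗ {x : S} (hx : x ∈ e.baseSet) :
    e.linearMapAt ℝ x ∘ₗ e.symmₗ ℝ x = LinearMap.id :=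
  LinearMap.ext (e.linearMapAt_symmₗ hx)

/-- The coordinates of an element of `⋀(V x ⊕ V x*)` in a trivialization. -/
noncomputable def ghostCoord (x : S) : GhostAlgebra (V x) →ₐ[ℝ] GhostAlgebra F :=
  ghostMap (e.linearMapAt ℝ x) (e.symmₗ ℝ x)

/-- The element of `⋀(V x ⊕ V x*)` with given coordinates in a trivialization. -/
noncomputable def ghostOfCoord (x : S) : GhostAlgebra F →ₐ[ℝ] GhostAlgebra (V x) :=
  ghostMap (e.symmₗ ℝ x) (e.linearMapAt ℝ x)

theorem ghostCoord_ghostOfCoord {x : S} (hx : x ∈ e.baseSet) (z : GhostAlgebra F) :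
    ghostCoord e x (ghostOfCoord e x z) = z :=
  ghostMap_ghostMap_of_leftInverse (linearMapAt_comp_symmₗ e hx) z

theorem ghostOfCoord_ghostCoord {x : S} (hx : x ∈ e.baseSet) (z : GhostAlgebra (V x)) :
    ghostOfCoord e x (ghostCoord e x z) = z :=
  ghostMap_ghostMap_of_leftInverse (symmₗ_comp_linearMapAt e hx) z

theorem ghostCoord_ghostContract {x : S} (hx : x ∈ e.baseSet) (w : V x) (z : GhostAlgebra (V x)) :
    ghostCoord e x (ghostContract w z) =
      ghostContract (e.linearMapAt ℝ x w) (ghostCoord e x z) :=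
  ghostMap_ghostContract (symmₗ_comp_linearMapAt e hx) w z

theorem ghostOfCoord_ghostContract {x : S} (hx : x ∈ e.baseSet) (w : F) (z : GhostAlgebra F) :
    ghostOfCoord e x (ghostContract w z) =
      ghostContract (e.symmₗ ℝ x w) (ghostOfCoord e x z) :=
  ghostMap_ghostContract (linearMapAt_comp_symmₗ e hx) w z

variable [ContMDiffVectorBundle ∞ F V 𝓘(ℝ, EB)] [FiniteDimensional ℝ F]

theorem contMDiffAt_linearMapAt_symmₗ {v₀ : TotalSpace F V} (h : v₀.proj ∈ e.baseSet)
    (h' : v₀.proj ∈ e'.baseSet) (u : F) :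
    ContMDiffAt (𝓘(ℝ, EB).prod 𝓘(ℝ, F)) 𝓘(ℝ, F) ∞
      (fun v : TotalSpace F V => e'.linearMapAt ℝ v.proj (e.symmₗ ℝ v.proj u)) v₀ := by
  have h1 : ContMDiffAt (𝓘(ℝ, EB).prod 𝓘(ℝ, F)) 𝓘(ℝ, F →L[ℝ] F) ∞
      (fun v : TotalSpace F V => (e.coordChangeL ℝ e' v.proj : F →L[ℝ] F)) v₀ :=
    (contMDiffAt_proj V).coordChangeL h h'
  refine (h1.clm_apply (contMDiffAt_const (c := u))).congr_of_eventuallyEq ?_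
  have hmem : (π F V) ⁻¹' (e.baseSet ∩ e'.baseSet) ∈ nhds v₀ :=
    (FiberBundle.continuous_proj F V).continuousAt.preimage_mem_nhds
      ((e.open_baseSet.inter e'.open_baseSet).mem_nhds ⟨h, h'⟩)
  filter_upwards [hmem] with v hv
  rw [ContinuousLinearEquiv.coe_coe, e.coordChangeL_apply e' hv,
    e'.coe_linearMapAt_of_mem hv.2, e.symmₗ_apply hv.1]

theorem preimage_baseSet_mem_nhds {v₀ : TotalSpace F V} (h : v₀.proj ∈ e.baseSet) :
    (π F V) ⁻¹' e.baseSet ∈ nhds v₀ :=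
  (FiberBundle.continuous_proj F V).continuousAt.preimage_mem_nhds (e.open_baseSet.mem_nhds h)

/-- It suffices to treat generators: ghosts change by the transition map from `e` to `e'`, momenta
by the transpose of the one from `e'` to `e`. -/
theorem isSmoothGhostAt_transition {v₀ : TotalSpace F V} (h : v₀.proj ∈ e.baseSet)
    (h' : v₀.proj ∈ e'.baseSet) (z : GhostAlgebra F) :
    IsSmoothGhostAt EB (fun v => ghostCoord e' v.proj (ghostOfCoord e v.proj z)) v₀ := by
  induction z using ExteriorAlgebra.induction with
  | algebraMap r => simp only [AlgHom.commutes]; exact isSmoothGhostAt_const _ _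
  | add a b ha hb => intro φ; simp only [map_add]; exact (ha φ).add (hb φ)
  | mul a b ha hb => simp only [map_mul]; exact ha.mul hb
  | ι m =>
    intro φ
    simp only [ι_eq_ghost_add_ghostMomentum, map_add, ghostCoord, ghostOfCoord, ghostMap_ghost,
      ghostMap_ghostMomentum]
    refine ContMDiffAt.add ?_ ?_
    · have h1 := contMDiffAt_linearMapAt_symmₗ (EB := EB) e e' h h' m.1
      exact (LinearMap.toContinuousLinearMap (φ ∘ₗ (ghost : F →ₗ[ℝ] GhostAlgebra F))).contMDiff
        |>.contMDiffAt.comp v₀ h1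
    -- By reflexivity of `F`, the form `φ` restricted to momenta is evaluation at a vector `w`. The
    -- transpose then disappears: the covector `m.2` is evaluated on the smooth image of `w`.
    · obtain ⟨w, hw⟩ := (Module.evalEquiv ℝ F).surjective
        (φ ∘ₗ (ghostMomentum : Module.Dual ℝ F →ₗ[ℝ] GhostAlgebra F))
      have h1 := contMDiffAt_linearMapAt_symmₗ (EB := EB) e' e h' h w
      refine ((LinearMap.toContinuousLinearMap m.2).contMDiff.contMDiffAt.comp v₀ h1
        ).congr_of_eventuallyEq (Filter.Eventually.of_forall fun v => ?_)
      exact (LinearMap.congr_fun hw _).symm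

theorem IsSmoothGhostAt.change {X : ∀ v : TotalSpace F V, GhostAlgebra (V v.proj)}
    {v₀ : TotalSpace F V} (h : v₀.proj ∈ e.baseSet) (h' : v₀.proj ∈ e'.baseSet)
    (hX : IsSmoothGhostAt EB (fun v => ghostCoord e v.proj (X v)) v₀) :
    IsSmoothGhostAt EB (fun v => ghostCoord e' v.proj (X v)) v₀ := by
  let b := Module.finBasis ℝ (GhostAlgebra F)
  have h1 : IsSmoothGhostAt EB (fun v => ∑ i, b.coord i (ghostCoord e v.proj (X v)) •
      ghostCoord e' v.proj (ghostOfCoord e v.proj (b i))) v₀ :=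
    IsSmoothGhostAt.sum fun i _ => (isSmoothGhostAt_transition e e' h h' (b i)).smul (hX _)
  refine h1.congr ?_
  filter_upwards [preimage_baseSet_mem_nhds e h] with v hv
  conv_lhs => rw [← ghostOfCoord_ghostCoord e hv (X v), ← b.sum_repr (ghostCoord e v.proj (X v))]
  simp only [map_sum, map_smul]
  rfl

theorem IsSmoothGhostSection.isSmoothGhostAt
    {X : ∀ v : TotalSpace F V, GhostAlgebra (V v.proj)} (hX : IsSmoothGhostSection EB F V X)
    {v₀ : TotalSpace F V} (h : v₀.proj ∈ e.baseSet) :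
    IsSmoothGhostAt EB (fun v => ghostCoord e v.proj (X v)) v₀ :=
  IsSmoothGhostAt.change (trivializationAt F V v₀.proj) e
    (mem_baseSet_trivializationAt F V v₀.proj) h (hX v₀)

theorem contMDiffAt_comp_proj {χ : S → ℝ} (hχ : ContMDiff 𝓘(ℝ, EB) 𝓘(ℝ, ℝ) ∞ χ)
    (v₀ : TotalSpace F V) :
    ContMDiffAt (𝓘(ℝ, EB).prod 𝓘(ℝ, F)) 𝓘(ℝ, ℝ) ∞ (fun v : TotalSpace F V => χ v.proj) v₀ :=
  (hχ.contMDiffAt).comp v₀ (contMDiffAt_proj V)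

theorem eventually_eq_zero_of_notMem_tsupport {χ : S → ℝ} {v₀ : TotalSpace F V}
    (h : v₀.proj ∉ tsupport χ) : ∀ᶠ v : TotalSpace F V in nhds v₀, χ v.proj = 0 :=
  (FiberBundle.continuous_proj F V).continuousAt.eventually
    (notMem_tsupport_iff_eventuallyEq.1 h)

/-- Extension by zero: a point lies over the domain of the trivialization, or has a neighbourhood on
which `χ` vanishes. -/
theorem contMDiff_cutoff {χ : S → ℝ} (hχ : ContMDiff 𝓘(ℝ, EB) 𝓘(ℝ, ℝ) ∞ χ)
    (hsupp : tsupport χ ⊆ e.baseSet) {f : TotalSpace F V → ℝ}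
    (hf : ∀ v : TotalSpace F V, v.proj ∈ e.baseSet →
      ContMDiffAt (𝓘(ℝ, EB).prod 𝓘(ℝ, F)) 𝓘(ℝ, ℝ) ∞ f v) :
    ContMDiff (𝓘(ℝ, EB).prod 𝓘(ℝ, F)) 𝓘(ℝ, ℝ) ∞ (fun v : TotalSpace F V => χ v.proj * f v) := by
  intro v₀
  by_cases h : v₀.proj ∈ tsupport χ
  · exact (contMDiffAt_comp_proj hχ v₀).mul (hf v₀ (hsupp h))
  · refine (contMDiffAt_const (c := (0 : ℝ))).congr_of_eventuallyEq ?_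
    filter_upwards [eventually_eq_zero_of_notMem_tsupport h] with v hv
    rw [hv, zero_mul]

theorem isSmoothGhostSection_cutoff {χ : S → ℝ} (hχ : ContMDiff 𝓘(ℝ, EB) 𝓘(ℝ, ℝ) ∞ χ)
    (hsupp : tsupport χ ⊆ e.baseSet) {c : TotalSpace F V → GhostAlgebra F}
    (hc : ∀ v : TotalSpace F V, v.proj ∈ e.baseSet → IsSmoothGhostAt EB c v) :
    IsSmoothGhostSection EB F V (fun v => χ v.proj • ghostOfCoord e v.proj (c v)) := by
  intro v₀
  by_cases h : v₀.proj ∈ tsupport χ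
  · refine IsSmoothGhostAt.change (EB := EB) e (trivializationAt F V v₀.proj) (hsupp h)
      (mem_baseSet_trivializationAt F V v₀.proj) ?_
    refine ((hc v₀ (hsupp h)).smul (contMDiffAt_comp_proj hχ v₀)).congr ?_
    filter_upwards [preimage_baseSet_mem_nhds e (hsupp h)] with v hv
    rw [map_smul, ghostCoord_ghostOfCoord e hv]
  · intro φ
    refine (contMDiffAt_const (c := (0 : ℝ))).congr_of_eventuallyEq ?_
    filter_upwards [eventually_eq_zero_of_notMem_tsupport h] with v hv
    rw [hv, zero_smul, map_zero, map_zero]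

/-- For a cutoff function `χ` supported in the domain of a trivialization, the algebra map
`⋀(F ⊕ F*) → BFV(E)` that sends a generator to the corresponding constant local section times
`χ`. -/
noncomputable def bfvFrame {χ : S → ℝ} (hχ : ContMDiff 𝓘(ℝ, EB) 𝓘(ℝ, ℝ) ∞ χ)
    (hsupp : tsupport χ ⊆ e.baseSet) : GhostAlgebra F →ₐ[ℝ] BFV EB F V :=
  ExteriorAlgebra.lift ℝ
    ⟨{ toFun := fun m => ⟨fun v => χ v.proj • ghostOfCoord e v.proj (ExteriorAlgebra.ι ℝ m),
          isSmoothGhostSection_cutoff e hχ hsupp fun v _ => isSmoothGhostAt_const _ v⟩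
       map_add' := fun m n => Subtype.ext <| funext fun v => by
          simp only [map_add, smul_add]; rfl
       map_smul' := fun r m => Subtype.ext <| funext fun v => by
          simp only [map_smul, smul_comm _ r]; rfl },
      fun m => Subtype.ext <| funext fun v => by
        change (χ v.proj • ghostOfCoord e v.proj (ExteriorAlgebra.ι ℝ m)) *
          (χ v.proj • ghostOfCoord e v.proj (ExteriorAlgebra.ι ℝ m)) = 0
        rw [smul_mul_smul_comm, ← map_mul, ExteriorAlgebra.ι_sq_zero, map_zero, smul_zero]⟩

variable {χ : S → ℝ} (hχ : ContMDiff 𝓘(ℝ, EB) 𝓘(ℝ, ℝ) ∞ χ) (hsupp : tsupport χ ⊆ e.baseSet)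

theorem bfvFrame_ι (m : F × Module.Dual ℝ F) (v : TotalSpace F V) :
    (bfvFrame e hχ hsupp (ExteriorAlgebra.ι ℝ m)).1 v =
      χ v.proj • ghostOfCoord e v.proj (ExteriorAlgebra.ι ℝ m) := by
  rw [bfvFrame, ExteriorAlgebra.lift_ι_apply]
  rfl

variable (EB) in
/-- Evaluation of the elements of `BFV(E)` at a point of `E`. -/
noncomputable def bfvEval (v : TotalSpace F V) : BFV EB F V →ₐ[ℝ] GhostAlgebra (V v.proj) :=
  (Pi.evalAlgHom ℝ (fun v : TotalSpace F V => GhostAlgebra (V v.proj)) v).comp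
    (BFV EB F V).val

theorem bfvEval_apply (v : TotalSpace F V) (X : BFV EB F V) : bfvEval EB v X = X.1 v := rfl

/-- Each generator carries a factor `χ`, so bidegree `(p, q)` is scaled by `χ^(p+q)`. The frame is
undistorted where `χ = 1`, hence the need for a second, smaller cutoff later. -/
theorem bfvFrame_apply {v : TotalSpace F V} (hv : χ v.proj = 1) (z : GhostAlgebra F) :
    (bfvFrame e hχ hsupp z).1 v = ghostOfCoord e v.proj z := by
  have : (bfvEval EB v).comp (bfvFrame e hχ hsupp) = ghostOfCoord e v.proj := by
    refine ExteriorAlgebra.hom_ext (LinearMap.ext fun m => ?_)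
    exact (bfvFrame_ι e hχ hsupp m v).trans (by rw [hv, one_smul]; rfl)
  exact DFunLike.congr_fun this z

theorem bfvFrame_ghost (a : F) (v : TotalSpace F V) :
    (bfvFrame e hχ hsupp (ghost a)).1 v = ghost (χ v.proj • e.symmₗ ℝ v.proj a) := by
  rw [ghost_apply, bfvFrame_ι, ← ghost_apply, ghostOfCoord, ghostMap_ghost, map_smul]

theorem bfvFrame_ghostMomentum (β : Module.Dual ℝ F) (v : TotalSpace F V) :
    (bfvFrame e hχ hsupp (ghostMomentum β)).1 v =
      ghostMomentum (χ v.proj • β ∘ₗ e.linearMapAt ℝ v.proj) := by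
  rw [ghostMomentum_apply, bfvFrame_ι, ← ghostMomentum_apply, ghostOfCoord,
    ghostMap_ghostMomentum, map_smul]

end LocalSections

/-! ### Total degree against ghost-momentum filtration -/

section Grading

variable {EB : Type*} [NormedAddCommGroup EB] [NormedSpace ℝ EB]
  {S : Type*} [TopologicalSpace S] [ChartedSpace EB S]
  {F : Type*} [NormedAddCommGroup F] [NormedSpace ℝ F] [FiniteDimensional ℝ F]
  {V : S → Type*} [∀ x, AddCommGroup (V x)] [∀ x, Module ℝ (V x)]
  [TopologicalSpace (TotalSpace F V)] [∀ x, TopologicalSpace (V x)]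
  [FiberBundle F V] [VectorBundle ℝ F V]

theorem mem_bfvDegree_of_mem_bfvBidegree {p q : ℕ} {k : ℤ} (h : (p : ℤ) - q = k)
    {X : BFV EB F V} (hX : X ∈ bfvBidegree EB F V p q) : X ∈ bfvDegree EB F V k :=
  Submodule.mem_iSup_of_mem p (Submodule.mem_iSup_of_mem q (Submodule.mem_iSup_of_mem h hX))

/-- Induction on the components of a homogeneous element. -/
theorem bfvDegree_induction {k : ℤ} {C : BFV EB F V → Prop} (zero : C 0)
    (add : ∀ X Y, C X → C Y → C (X + Y))
    (mem : ∀ (p q : ℕ), (p : ℤ) - q = k → ∀ X ∈ bfvBidegree EB F V p q, C X)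
    {X : BFV EB F V} (hX : X ∈ bfvDegree EB F V k) : C X := by
  refine Submodule.iSup_induction _ (motive := C) hX (fun p X hX => ?_) zero add
  refine Submodule.iSup_induction _ (motive := C) hX (fun q X hX => ?_) zero add
  exact Submodule.iSup_induction _ (motive := C) hX (fun h X hX => mem p q h X hX) zero add

theorem bfvOfFun_mem_bfvDegree
    (f : C^∞⟮𝓘(ℝ, EB).prod 𝓘(ℝ, F), TotalSpace F V; 𝓘(ℝ, ℝ), ℝ⟯) :
    bfvOfFun f ∈ bfvDegree EB F V 0 :=
  mem_bfvDegree_of_mem_bfvBidegree (p := 0) (q := 0) (by simp)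
    fun v => algebraMap_mem_ghostBidegree (f v)

theorem ghostInvolute_of_mem_bfvDegree {k : ℤ} {X : BFV EB F V} (hX : X ∈ bfvDegree EB F V k)
    (v : TotalSpace F V) :
    ghostInvolute (V v.proj) (X.1 v) = (k.negOnePow : ℤ) • X.1 v := by
  refine bfvDegree_induction (C := fun X => ghostInvolute (V v.proj) (X.1 v) =
    (k.negOnePow : ℤ) • X.1 v) ?_ ?_ ?_ hX
  · simp
  · intro X Y hX hY
    change ghostInvolute (V v.proj) (X.1 v + Y.1 v) = (k.negOnePow : ℤ) • (X.1 v + Y.1 v)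
    rw [map_add, hX, hY, smul_add]
  · rintro p q rfl X hX
    rw [ghostInvolute_of_mem_ghostBidegree (hX v)]
    rcases Nat.even_or_odd (p + q) with h | h
    · rw [Int.negOnePow_even _ (by rw [Int.even_sub]; exact_mod_cast Nat.even_add.1 h), h.neg_one_pow]
      simp
    · rw [Int.negOnePow_odd _ (by rw [Int.odd_sub]; exact_mod_cast Nat.odd_add.1 h), h.neg_one_pow]
      simp

theorem finiteDimensional_fibre (e : Trivialization F (π F V)) [e.IsLinear ℝ] {x : S}
    (hx : x ∈ e.baseSet) : FiniteDimensional ℝ (V x) :=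
  (e.linearEquivAt ℝ x hx).symm.finiteDimensional

/-- The leading component of a homogeneous element of `BFV_{≥ r}`. -/
theorem exists_leading_component {k r : ℕ} {X : BFV EB F V} (hX : X ∈ bfvDegree EB F V k)
    (hr : X ∈ bfvGE EB F V r) :
    ∃ Y ∈ bfvBidegree EB F V (r + k) r, X - Y ∈ bfvGE EB F V (r + 1) := by
  -- The induction is over an arbitrary decomposition of `X`, whose summands need not lie in `BFV_{≥
  -- r}`. The additive condition "no other component of momentum degree `r`" survives it; the
  -- filtration is used only afterwards.
  have h : ∃ Y ∈ bfvBidegree EB F V (r + k) r,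
      ∀ v, X.1 v - Y.1 v ∈ ghostNe (V v.proj) r := by
    refine bfvDegree_induction (C := fun X => ∃ Y ∈ bfvBidegree EB F V (r + k) r,
      ∀ v, X.1 v - Y.1 v ∈ ghostNe (V v.proj) r) ?_ ?_ ?_ hX
    · exact ⟨0, zero_mem _, fun v => by simp⟩
    · rintro X X' ⟨Y, hY, h⟩ ⟨Y', hY', h'⟩
      refine ⟨Y + Y', add_mem hY hY', fun v => ?_⟩
      have := add_mem (h v) (h' v)
      rwa [sub_add_sub_comm] at this
    · intro p q hpq X hX
      by_cases hq : q = r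
      · obtain rfl : p = r + k := by omega
        subst hq
        exact ⟨X, hX, fun v => by simp⟩
      · refine ⟨0, zero_mem _, fun v => ?_⟩
        have : X.1 v ∈ ghostNe (V v.proj) r :=
          Submodule.mem_iSup_of_mem p (Submodule.mem_iSup_of_mem q
            (Submodule.mem_iSup_of_mem hq (hX v)))
        simpa using this
  obtain ⟨Y, hY, h⟩ := h
  refine ⟨Y, hY, fun v => ?_⟩
  have := finiteDimensional_fibre _ (mem_baseSet_trivializationAt F V v.proj)
  exact sub_mem_ghostGE_succ (hr v) (hY v) (h v)

theorem sub_algebraMap_mem_ghostGE_one {X : BFV EB F V} (hX : X ∈ bfvDegree EB F V 0)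
    (v : TotalSpace F V) :
    X.1 v - algebraMap ℝ (GhostAlgebra (V v.proj)) (bfvToFun X v) ∈ ghostGE (V v.proj) 1 := by
  refine bfvDegree_induction (C := fun X =>
    X.1 v - algebraMap ℝ (GhostAlgebra (V v.proj)) (bfvToFun X v) ∈ ghostGE (V v.proj) 1)
    ?_ ?_ ?_ hX
  · simp [bfvToFun]
  · intro X Y hX hY
    have := add_mem hX hY
    rwa [sub_add_sub_comm, ← map_add, bfvToFun, bfvToFun, ← map_add] at this
  · intro p q hpq X hX
    obtain rfl : p = q := by omega
    rcases Nat.eq_zero_or_pos p with rfl | hp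
    · have h := hX v
      rw [ghostBidegree_zero_zero, Submodule.mem_one] at h
      obtain ⟨r, hr⟩ := h
      rw [bfvToFun, ← hr, ExteriorAlgebra.algebraMap_leftInverse]
      simp
    · rw [bfvToFun, algebraMapInv_of_mem_ghostBidegree (by omega) (hX v)]
      simpa using ghostBidegree_le_ghostGE (W := V v.proj) (show 1 ≤ p from hp) (hX v)

/-- Every component has `q = p - k ≥ -k ≥ r`. -/
theorem mem_bfvGE_of_mem_bfvDegree {k : ℤ} {r : ℕ} (hk : k + r ≤ 0) {X : BFV EB F V}
    (hX : X ∈ bfvDegree EB F V k) : X ∈ bfvGE EB F V r := by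
  refine bfvDegree_induction (C := fun X => X ∈ bfvGE EB F V r) (zero_mem _)
    (fun X Y => add_mem) ?_ hX
  exact fun p q hpq X hX v => ghostBidegree_le_ghostGE (by omega) (hX v)

theorem bfvBidegree_le_bfvGE {p q r : ℕ} (h : r ≤ q) :
    bfvBidegree EB F V p q ≤ bfvGE EB F V r :=
  fun _ hX v => ghostBidegree_le_ghostGE h (hX v)

theorem bfvGE_antitone {r s : ℕ} (h : r ≤ s) : bfvGE EB F V s ≤ bfvGE EB F V r :=
  fun _ hX v => ghostGE_antitone h (hX v)

theorem eq_zero_of_mem_bfvGE {r : ℕ} (h : Module.finrank ℝ F < r) {X : BFV EB F V}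
    (hX : X ∈ bfvGE EB F V r) : X = 0 := by
  refine Subtype.ext <| funext fun v => ?_
  have h1 : Module.finrank ℝ (V v.proj) = Module.finrank ℝ F :=
    ((trivializationAt F V v.proj).linearEquivAt ℝ v.proj
      (mem_baseSet_trivializationAt F V v.proj)).finrank_eq
  have := finiteDimensional_fibre _ (mem_baseSet_trivializationAt F V v.proj)
  have h2 := hX v
  rw [ghostGE_eq_bot (by omega)] at h2
  exact (Submodule.mem_bot ℝ).1 h2

end Grading

/-! ### Derivations at a point and the filtration -/

section PointDerivations

variable {EB : Type*} [NormedAddCommGroup EB] [NormedSpace ℝ EB] [FiniteDimensional ℝ EB]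
  {S : Type*} [TopologicalSpace S] [T2Space S] [ChartedSpace EB S] [IsManifold 𝓘(ℝ, EB) ∞ S]
  {F : Type*} [NormedAddCommGroup F] [NormedSpace ℝ F] [FiniteDimensional ℝ F]
  {V : S → Type*} [∀ x, AddCommGroup (V x)] [∀ x, Module ℝ (V x)]
  [TopologicalSpace (TotalSpace F V)] [∀ x, TopologicalSpace (V x)]
  [FiberBundle F V] [VectorBundle ℝ F V]

/-- A graded derivation of degree `d` on `BFV(E)` with values at a point `v` of `E`. -/
def IsPointDerivation (v : TotalSpace F V) (d : ℤ)
    (D : BFV EB F V →ₗ[ℝ] GhostAlgebra (V v.proj)) : Prop :=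
  ∀ (k : ℤ) (X Y : BFV EB F V), X ∈ bfvDegree EB F V k →
    D (X * Y) = D X * Y.1 v + ((d * k).negOnePow : ℤ) • (X.1 v * D Y)

theorem IsPointDerivation.ofFun_mul {v : TotalSpace F V} {d : ℤ}
    {D : BFV EB F V →ₗ[ℝ] GhostAlgebra (V v.proj)} (hD : IsPointDerivation v d D)
    (f : C^∞⟮𝓘(ℝ, EB).prod 𝓘(ℝ, F), TotalSpace F V; 𝓘(ℝ, ℝ), ℝ⟯) (X : BFV EB F V) :
    D (bfvOfFun f * X) = D (bfvOfFun f) * X.1 v + f v • D X := by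
  rw [hD 0 _ _ (bfvOfFun_mem_bfvDegree f), mul_zero, Int.negOnePow_zero, Units.val_one, one_smul,
    Algebra.smul_def]
  rfl

/-- The frame built from `χ` is honest wherever `χ'` is nonzero, so a section multiplied by `χ'`
expands globally in that frame. This substitutes for locality of a derivation. -/
theorem exists_nested_cutoffs {U : Set S} (hU : IsOpen U) {x : S} (hx : x ∈ U) :
    ∃ χ χ' : S → ℝ, ContMDiff 𝓘(ℝ, EB) 𝓘(ℝ, ℝ) ∞ χ ∧ ContMDiff 𝓘(ℝ, EB) 𝓘(ℝ, ℝ) ∞ χ' ∧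
      tsupport χ ⊆ U ∧ tsupport χ' ⊆ U ∧ χ' x = 1 ∧ ∀ y, χ' y ≠ 0 → χ y = 1 := by
  obtain ⟨f, -, hf⟩ := ((SmoothBumpFunction.nhds_basis_tsupport (I := 𝓘(ℝ, EB)) x).mem_iff).1
    (hU.mem_nhds hx)
  have hN : U ∩ {y | f y = 1} ∈ nhds x :=
    Filter.inter_mem (hU.mem_nhds hx) f.eventuallyEq_one
  obtain ⟨g, -, hg⟩ := ((SmoothBumpFunction.nhds_basis_tsupport (I := 𝓘(ℝ, EB)) x).mem_iff).1 hN
  exact ⟨f, g, f.contMDiff, g.contMDiff, hf, hg.trans Set.inter_subset_left, g.eq_one,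
    fun y hy => (hg (subset_tsupport _ hy)).2⟩

variable [ContMDiffVectorBundle ∞ F V 𝓘(ℝ, EB)]

theorem bfvFrame_mem_bfvBidegree (e : Trivialization F (π F V)) [MemTrivializationAtlas e]
    {χ : S → ℝ} (hχ : ContMDiff 𝓘(ℝ, EB) 𝓘(ℝ, ℝ) ∞ χ) (hsupp : tsupport χ ⊆ e.baseSet)
    {p q : ℕ} {z : GhostAlgebra F} (hz : z ∈ ghostBidegree F p q) :
    bfvFrame e hχ hsupp z ∈ bfvBidegree EB F V p q := by
  intro v
  refine ghostBidegree_induction (C := fun p q z =>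
    (bfvFrame e hχ hsupp z).1 v ∈ ghostBidegree (V v.proj) p q) ?_ ?_ ?_ ?_ hz
  · intro r
    rw [AlgHom.commutes]
    exact algebraMap_mem_ghostBidegree r
  · intro p q x y hx hy
    rw [map_add]
    exact add_mem hx hy
  · intro q β x _ hx
    rw [map_mul]
    change (bfvFrame e hχ hsupp (ghostMomentum β)).1 v * (bfvFrame e hχ hsupp x).1 v ∈ _
    rw [bfvFrame_ghostMomentum]
    simpa only [add_comm, zero_add] using
      mul_mem_ghostBidegree (ghostMomentum_mem_ghostBidegree _) hx
  · intro p q a x _ hx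
    rw [map_mul]
    change (bfvFrame e hχ hsupp (ghost a)).1 v * (bfvFrame e hχ hsupp x).1 v ∈ _
    rw [bfvFrame_ghost]
    simpa only [add_comm, zero_add, add_zero] using
      mul_mem_ghostBidegree (ghost_mem_ghostBidegree _) hx

/-- A point derivation of `BFV(E)` that maps ghost momenta to `⋀𝓔 ⊗ ⋀^{≥ 1} 𝓔*` preserves the
filtration by ghost-momentum degree. -/
theorem IsPointDerivation.mem_ghostGE {v : TotalSpace F V} {d : ℤ}
    {D : BFV EB F V →ₗ[ℝ] GhostAlgebra (V v.proj)} (hD : IsPointDerivation v d D)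
    (hmom : ∀ (Y : BFV EB F V) (α : ∀ v : TotalSpace F V, Module.Dual ℝ (V v.proj)),
      (∀ v, Y.1 v = ghostMomentum (α v)) → D Y ∈ ghostGE (V v.proj) 1)
    {q : ℕ} {Y : BFV EB F V} (hY : Y ∈ bfvGE EB F V q) : D Y ∈ ghostGE (V v.proj) q := by
  set e := trivializationAt F V v.proj with he
  obtain ⟨χ, χ', hχ, hχ', hs, hs', h1, hχχ'⟩ := exists_nested_cutoffs (EB := EB) e.open_baseSet
    (mem_baseSet_trivializationAt F V v.proj)
  let κ := bfvFrame e hχ hs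
  have hκ : ∀ p q z, z ∈ ghostBidegree F p q → D (κ z) ∈ ghostGE (V v.proj) q := by
    intro p q z hz
    refine ghostBidegree_induction (C := fun p q z => D (κ z) ∈ ghostGE (V v.proj) q)
      ?_ ?_ ?_ ?_ hz
    · exact fun r => mem_ghostGE_zero _
    · intro p q x y hx hy
      rw [map_add, map_add]; exact add_mem hx hy
    -- Only a momentum factor adds to the filtration degree, so only here must its image under `D`
    -- be controlled; images of functions and ghosts may be arbitrary.
    · intro q β x hx hx'
      rw [map_mul, hD (-1) _ _ (mem_bfvDegree_of_mem_bfvBidegree (p := 0) (q := 1) (by simp)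
        (bfvFrame_mem_bfvBidegree e hχ hs (ghostMomentum_mem_ghostBidegree β)))]
      refine add_mem ?_ (Submodule.smul_of_tower_mem _ _ ?_)
      · rw [add_comm]
        exact mul_mem_ghostGE (hmom _ _ (bfvFrame_ghostMomentum e hχ hs β))
          (ghostBidegree_le_ghostGE le_rfl (bfvFrame_mem_bfvBidegree e hχ hs hx v))
      · rw [add_comm]
        exact mul_mem_ghostGE (ghostBidegree_le_ghostGE le_rfl (bfvFrame_mem_bfvBidegree e hχ hs
          (ghostMomentum_mem_ghostBidegree β) v)) hx'
    · intro p q a x hx hx'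
      rw [map_mul, hD 1 _ _ (mem_bfvDegree_of_mem_bfvBidegree (p := 1) (q := 0) (by simp)
        (bfvFrame_mem_bfvBidegree e hχ hs (ghost_mem_ghostBidegree a)))]
      refine add_mem ?_ (Submodule.smul_of_tower_mem _ _ ?_)
      · exact mul_mem_ghostGE_right _
          (ghostBidegree_le_ghostGE le_rfl (bfvFrame_mem_bfvBidegree e hχ hs hx v))
      · exact mul_mem_ghostGE_right _ hx'
  have hκ' : ∀ z ∈ ghostGE F q, D (κ z) ∈ ghostGE (V v.proj) q := by
    intro z hz
    have : ghostGE F q ≤ (ghostGE (V v.proj) q).comap (D ∘ₗ κ.toLinearMap) :=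
      iSup_le fun p' => iSup_le fun q' => iSup_le fun hq z hz =>
        ghostGE_antitone hq (hκ p' q' z hz)
    exact this hz
  -- Coordinates on the filtration step are extended to the whole algebra along a complement. Being
  -- linear forms, they give smooth coefficients when applied to `Y`.
  obtain ⟨G, hG⟩ := (ghostGE F q).exists_isCompl
  let b := Module.finBasis ℝ (ghostGE F q)
  let c : Fin _ → Module.Dual ℝ (GhostAlgebra F) := fun i =>
    b.coord i ∘ₗ (ghostGE F q).projectionOnto G hG
  have hc : ∀ z ∈ ghostGE F q, z = ∑ i, c i z • (b i : GhostAlgebra F) := by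
    intro z hz
    have h := congrArg (Subtype.val) (b.sum_repr ⟨z, hz⟩)
    rw [← Submodule.subtype_apply, map_sum] at h
    refine h.symm.trans (Finset.sum_congr rfl fun i _ => ?_)
    rw [map_smul]
    congr 1
    simp only [c, LinearMap.comp_apply]
    rw [Submodule.projectionOnto_apply_left hG ⟨z, hz⟩]
    rfl
  let f : Fin _ → C^∞⟮𝓘(ℝ, EB).prod 𝓘(ℝ, F), TotalSpace F V; 𝓘(ℝ, ℝ), ℝ⟯ := fun i =>
    ⟨fun w => χ' w.proj * c i (ghostCoord e w.proj (Y.1 w)), contMDiff_cutoff e hχ' hs'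
      fun w hw => IsSmoothGhostSection.isSmoothGhostAt e Y.2 hw (c i)⟩
  let g : C^∞⟮𝓘(ℝ, EB).prod 𝓘(ℝ, F), TotalSpace F V; 𝓘(ℝ, ℝ), ℝ⟯ :=
    ⟨fun w => χ' w.proj, contMDiffAt_comp_proj hχ'⟩
  have hsum : bfvOfFun g * Y = ∑ i, bfvOfFun (f i) * κ (b i) := by
    refine Subtype.ext <| funext fun w => ?_
    have e1 : (bfvOfFun g * Y).1 w = χ' w.proj • Y.1 w :=
      (Algebra.smul_def (χ' w.proj) (Y.1 w)).symm
    have e2 : (∑ i, bfvOfFun (f i) * κ (b i)).1 w =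
        ∑ i, (χ' w.proj * c i (ghostCoord e w.proj (Y.1 w))) • (κ (b i)).1 w := by
      rw [← bfvEval_apply, map_sum]
      exact Finset.sum_congr rfl fun i _ => (Algebra.smul_def
        (χ' w.proj * c i (ghostCoord e w.proj (Y.1 w))) ((κ (b i)).1 w)).symm
    rw [e1, e2]
    by_cases hw : χ' w.proj = 0
    · simp [hw]
    · have hb : w.proj ∈ e.baseSet := hs' (subset_tsupport _ hw)
      simp only [κ, bfvFrame_apply e hχ hs (hχχ' _ hw), mul_smul, ← Finset.smul_sum]
      congr 1
      have hz : ghostCoord e w.proj (Y.1 w) ∈ ghostGE F q := ghostMap_mem_ghostGE _ _ (hY w)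
      conv_lhs => rw [← ghostOfCoord_ghostCoord e hb (Y.1 w), hc _ hz]
      rw [map_sum]
      exact Finset.sum_congr rfl fun i _ => map_smul _ _ _
  -- As `g v = 1`, the Leibniz rule turns the identity for `g Y` into `D Y = ∑ D(f i · κ(b i)) -
  -- D(g) · Y(v)`. All terms on the right lie in the filtration step.
  have h2 := congrArg D hsum
  rw [hD.ofFun_mul, map_sum] at h2
  have h3 : g v = 1 := h1
  rw [h3, one_smul] at h2
  rw [eq_sub_of_add_eq' h2]
  refine sub_mem (sum_mem fun i _ => ?_) (mul_mem_ghostGE_right _ (hY v))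
  rw [hD.ofFun_mul]
  refine add_mem (mul_mem_ghostGE_right _ ?_) (Submodule.smul_mem _ _ (hκ' _ (b i).2))
  have h4 : (κ (b i)).1 v = ghostOfCoord e v.proj (b i) :=
    bfvFrame_apply e hχ hs (hχχ' _ (by rw [h1]; exact one_ne_zero)) _
  rw [h4]
  exact ghostMap_mem_ghostGE _ _ (b i).2

end PointDerivations

/-! ### Radial integrals and the Koszul homotopy on a vector space -/

section RadialIntegral

/-- The integral over `[0, 1]` of a smooth function depending smoothly on parameters is smooth. -/
theorem contDiffOn_parametric_unitInterval {P : Type*} [NormedAddCommGroup P] [NormedSpace ℝ P]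
    {U : Set P} (hU : IsOpen U) {G : P → ℝ → ℝ}
    (hG : ContDiffOn ℝ ∞ (fun z : P × ℝ => G z.1 z.2) (U ×ˢ Set.univ)) :
    ContDiffOn ℝ ∞ (fun p => ∫ t in (0 : ℝ)..1, G p t) U := by
  -- The integral is the convolution at `0` of the indicator of `(0, 1]` with `s ↦ η(s) G(p, -s)`.
  -- Here `η` equals `1` on `[-1, 1]`, so it does not change the integral, and it makes the second
  -- factor compactly supported.
  let η : ContDiffBump (0 : ℝ) := ⟨1, 2, one_pos, one_lt_two⟩
  let f : ℝ → ℝ := (Set.Ioc (0 : ℝ) 1).indicator 1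
  have hf : MeasureTheory.LocallyIntegrable f MeasureTheory.volume :=
    ((MeasureTheory.integrableOn_const (by simp)).integrable_indicator
      measurableSet_Ioc).locallyIntegrable
  have hg : ContDiffOn ℝ ∞ (fun z : P × ℝ => η z.2 * G z.1 (-z.2)) (U ×ˢ Set.univ) := by
    refine (η.contDiff.comp contDiff_snd).contDiffOn.mul ?_
    have h1 : ContDiff ℝ ∞ (fun z : P × ℝ => (z.1, -z.2)) := contDiff_fst.prodMk contDiff_snd.neg
    exact hG.comp h1.contDiffOn fun z hz => ⟨hz.1, trivial⟩
  have h := MeasureTheory.contDiffOn_convolution_right_with_param_comp (μ := MeasureTheory.volume)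
    (n := ⊤) (ContinuousLinearMap.mul ℝ ℝ)
    (v := fun _ : P => (0 : ℝ)) contDiffOn_const (f := f)
    (g := fun p s => η s * G p (-s)) hU (isCompact_closedBall (0 : ℝ) 2)
    (fun p x _ hx => by
      rw [η.zero_of_le_dist, zero_mul]
      rw [Metric.mem_closedBall, not_le] at hx
      exact hx.le) hf hg
  refine h.congr fun p _ => ?_
  rw [intervalIntegral.integral_of_le zero_le_one,
    ← MeasureTheory.integral_indicator measurableSet_Ioc]
  refine MeasureTheory.integral_congr_ae (Filter.Eventually.of_forall fun t => ?_)
  simp only [f, ContinuousLinearMap.mul_apply', zero_sub, neg_neg]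
  by_cases ht : t ∈ Set.Ioc (0 : ℝ) 1
  · rw [Set.indicator_of_mem ht, Set.indicator_of_mem ht, Pi.one_apply, one_mul,
      η.one_of_mem_closedBall, one_mul]
    rw [Metric.mem_closedBall, dist_zero_right, norm_neg, Real.norm_of_nonneg ht.1.le]
    exact ht.2
  · rw [Set.indicator_of_notMem ht, Set.indicator_of_notMem ht, zero_mul]

/-- The radial homotopy formula for the Koszul complex. -/
theorem koszul_radial_homotopy {F Λ ι : Type*} [NormedAddCommGroup F] [NormedSpace ℝ F]
    [NormedAddCommGroup Λ] [NormedSpace ℝ Λ] [CompleteSpace Λ] [Fintype ι]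
    (b : Module.Basis ι ℝ F) (C : F →L[ℝ] Λ →L[ℝ] Λ) (m : ι → Λ →L[ℝ] Λ)
    (hCm : ∀ i y z, C y (m i z) = b.coord i y • z - m i (C y z))
    {ρ : F → Λ} (hρ : ContDiff ℝ 1 ρ) {q : ℕ}
    (hq : ∀ y, ∑ i, m i (C (b i) (ρ y)) = (q : ℝ) • ρ y) (h0 : ∀ y, C y (ρ y) = 0)
    (h00 : q = 0 → ρ 0 = 0) (y : F) :
    C y (∑ i, m i (∫ t in (0 : ℝ)..1, t ^ q • fderiv ℝ ρ (t • y) (b i))) = ρ y := by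
  have hd : Continuous (fun t : ℝ => fderiv ℝ ρ (t • y)) :=
    (hρ.continuous_fderiv one_ne_zero).comp (continuous_id.smul continuous_const)
  have hdc : ∀ w, Continuous (fun t : ℝ => t ^ q • fderiv ℝ ρ (t • y) w) := fun w =>
    (continuous_pow q).smul (hd.clm_apply continuous_const)
  have hder : ∀ w, HasFDerivAt ρ (fderiv ℝ ρ w) w := fun w =>
    (hρ.differentiable one_ne_zero w).hasFDerivAt
  -- Differentiate `C y (ρ y) = 0` at `t y` in the direction `w`.
  have hrel : ∀ (t : ℝ) (w : F), t • C y (fderiv ℝ ρ (t • y) w) = -C w (ρ (t • y)) := by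
    intro t w
    have h1 := (C.hasFDerivAt (x := t • y)).clm_apply (hder (t • y))
    have h2 : HasFDerivAt (fun y => C y (ρ y)) (0 : F →L[ℝ] Λ) (t • y) :=
      (hasFDerivAt_const (0 : Λ) (t • y)).congr_of_eventuallyEq
        (Filter.Eventually.of_forall h0)
    have h3 := DFunLike.congr_fun (h1.unique h2) w
    simp only [add_apply, ContinuousLinearMap.comp_apply,
      ContinuousLinearMap.flip_apply, zero_apply, map_smul,
      smul_apply] at h3
    exact eq_neg_of_add_eq_zero_left h3
  let A : ι → Λ →L[ℝ] Λ := fun i => (C y).comp (m i)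
  have e1 : C y (∑ i, m i (∫ t in (0 : ℝ)..1, t ^ q • fderiv ℝ ρ (t • y) (b i))) =
      ∫ t in (0 : ℝ)..1, ∑ i, A i (t ^ q • fderiv ℝ ρ (t • y) (b i)) := by
    rw [map_sum, intervalIntegral.integral_finsetSum]
    · refine Finset.sum_congr rfl fun i _ => ?_
      exact ((A i).intervalIntegral_comp_comm ((hdc (b i)).intervalIntegrable 0 1)).symm
    · exact fun i _ => ((A i).continuous.comp (hdc (b i))).intervalIntegrable 0 1
  -- For `t ≠ 0` the integrand is the derivative of `t^q ρ(t y)`: moving `C y` past `m i` gives `∂_y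
  -- ρ`, and `hrel` with the counting identity gives the term `(q/t) ρ`. The truncated exponent `q -
  -- 1` is harmless at `q = 0` because of the factor `q`.
  let g : ℝ → Λ := fun t => t ^ q • ρ (t • y)
  let g' : ℝ → Λ := fun t => t ^ q • fderiv ℝ ρ (t • y) y + ((q : ℝ) * t ^ (q - 1)) • ρ (t • y)
  have hg : ∀ t, HasDerivAt g (g' t) t := by
    intro t
    have h1 : HasDerivAt (fun t : ℝ => t • y) y t := by
      simpa using (hasDerivAt_id t).smul_const y
    exact (hasDerivAt_pow q t).smul ((hder (t • y)).comp_hasDerivAt t h1)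
  have hg'c : Continuous g' :=
    (hdc y).add ((continuous_const.mul (continuous_pow _)).smul
      (hρ.continuous.comp (continuous_id.smul continuous_const)))
  have e2 : ∀ t : ℝ, t ≠ 0 → ∑ i, A i (t ^ q • fderiv ℝ ρ (t • y) (b i)) = g' t := by
    intro t ht
    have h1 : ∑ i, m i (C y (fderiv ℝ ρ (t • y) (b i))) = -((t⁻¹ * q) • ρ (t • y)) := by
      rw [mul_smul, ← hq, Finset.smul_sum, ← Finset.sum_neg_distrib]
      refine Finset.sum_congr rfl fun i _ => ?_
      have := hrel t (b i)
      rw [← neg_eq_iff_eq_neg] at this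
      rw [← this, map_neg, map_smul, smul_neg, neg_neg, inv_smul_smul₀ ht]
    have h2 : ∑ i, b.coord i y • fderiv ℝ ρ (t • y) (b i) = fderiv ℝ ρ (t • y) y := by
      conv_rhs => rw [← b.sum_repr y, map_sum]
      simp [map_smul]
    simp only [A, ContinuousLinearMap.comp_apply, map_smul, hCm, ← Finset.smul_sum,
      Finset.sum_sub_distrib, h1, h2, g', sub_neg_eq_add, smul_add, smul_smul]
    congr 2
    rcases q with _ | q
    · simp
    · rw [pow_succ, Nat.add_sub_cancel]
      field_simp
  rw [e1, intervalIntegral.integral_congr_ae (g := g'),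
    intervalIntegral.integral_eq_sub_of_hasDerivAt (fun t _ => hg t)
      (hg'c.intervalIntegrable 0 1)]
  · simp only [g, one_pow, one_smul, zero_smul]
    -- The boundary term at `t = 0` is killed by `t^q` if `q > 0`; for `q = 0` it is `ρ 0`, the
    -- obstruction excluded by `h00`.
    rcases Nat.eq_zero_or_pos q with hq0 | hq0
    · rw [h00 hq0, smul_zero, sub_zero]
    · rw [zero_pow hq0.ne', zero_smul, sub_zero]
  · refine Filter.Eventually.of_forall fun t ht => e2 t ?_
    rw [Set.uIoc_of_le zero_le_one] at ht
    exact ht.1.ne'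

/-- The weighted radial integral `∫₀¹ t^q ∂_w h(t y) dt` of a directional derivative. -/
noncomputable def radialIntegral {F : Type*} [NormedAddCommGroup F] [NormedSpace ℝ F] (q : ℕ)
    (w : F) (h : F → ℝ) (y : F) : ℝ :=
  ∫ t in (0 : ℝ)..1, t ^ q * fderiv ℝ h (t • y) w

variable {F : Type*} [NormedAddCommGroup F] [NormedSpace ℝ F] [FiniteDimensional ℝ F]

/-- The coefficientwise weighted radial integral of a map with values in `⋀(F ⊕ F*)`. -/
noncomputable def ghostRadialIntegral (q : ℕ) (w : F) (ρ : F → GhostAlgebra F) (y : F) :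
    GhostAlgebra F :=
  ∑ k, radialIntegral q w
      (fun y' => (Module.finBasis ℝ (GhostAlgebra F)).coord k (ρ y')) y •
    Module.finBasis ℝ (GhostAlgebra F) k

/-- The radial primitive of a map with values in `⋀(F ⊕ F*)` for the contraction with the Euler
vector field. -/
noncomputable def ghostPrimitive (q : ℕ) (ρ : F → GhostAlgebra F) (y : F) : GhostAlgebra F :=
  ∑ i, ghostMomentum ((Module.finBasis ℝ F).coord i) *
    ghostRadialIntegral q (Module.finBasis ℝ F i) ρ y

/-- Were the value outside `G`, a linear form vanishing on `G` would detect it. But that form kills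
`ρ` identically, hence its derivatives and their integral. -/
theorem ghostRadialIntegral_mem {G : Submodule ℝ (GhostAlgebra F)} {ρ : F → GhostAlgebra F}
    (hρ : ∀ φ : Module.Dual ℝ (GhostAlgebra F), ContDiff ℝ ∞ (fun y => φ (ρ y)))
    (hG : ∀ y, ρ y ∈ G) (q : ℕ) (w y : F) : ghostRadialIntegral q w ρ y ∈ G := by
  set B := Module.finBasis ℝ (GhostAlgebra F) with hB
  by_contra hcon
  obtain ⟨φ, hφ, hφG⟩ := Submodule.exists_dual_map_eq_bot_of_notMem hcon inferInstance
  refine hφ ?_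
  have hφ0 : ∀ y, φ (ρ y) = 0 := fun y => by
    have : φ (ρ y) ∈ G.map φ := ⟨_, hG y, rfl⟩
    rwa [hφG] at this
  have hexp : ∀ y, φ (ρ y) = ∑ k, B.coord k (ρ y) * φ (B k) := fun y => by
    conv_lhs => rw [← B.sum_repr (ρ y), map_sum]
    simp
  have hdiff : ∀ k y, DifferentiableAt ℝ (fun y => B.coord k (ρ y)) y := fun k y =>
    (hρ (B.coord k)).differentiable (by simp) y
  have hint : ∀ k, IntervalIntegrable (fun t : ℝ => φ (B k) *
      (t ^ q * fderiv ℝ (fun y => B.coord k (ρ y)) (t • y) w)) MeasureTheory.volume 0 1 :=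
    fun k => (continuous_const.mul ((continuous_pow q).mul
      ((((hρ (B.coord k)).continuous_fderiv (by simp)).comp
        (continuous_id.smul continuous_const)).clm_apply continuous_const))).intervalIntegrable 0 1
  rw [ghostRadialIntegral, map_sum]
  simp only [map_smul, smul_eq_mul, radialIntegral, ← hB]
  calc _ = ∑ k, ∫ t in (0 : ℝ)..1, φ (B k) *
        (t ^ q * fderiv ℝ (fun y => B.coord k (ρ y)) (t • y) w) := by
        refine Finset.sum_congr rfl fun k _ => ?_
        rw [intervalIntegral.integral_const_mul, mul_comm]
    _ = ∫ t in (0 : ℝ)..1, ∑ k, φ (B k) *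
        (t ^ q * fderiv ℝ (fun y => B.coord k (ρ y)) (t • y) w) :=
        (intervalIntegral.integral_finsetSum fun k _ => hint k).symm
    _ = ∫ t in (0 : ℝ)..1, 0 := by
        congr 1
        funext t
        have h1 : HasFDerivAt (fun y => ∑ k, B.coord k (ρ y) * φ (B k))
            (∑ k, φ (B k) • fderiv ℝ (fun y => B.coord k (ρ y)) (t • y)) (t • y) :=
          HasFDerivAt.fun_sum fun k _ => (hdiff k (t • y)).hasFDerivAt.mul_const (φ (B k))
        have h2 : HasFDerivAt (fun y => ∑ k, B.coord k (ρ y) * φ (B k))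
            (0 : F →L[ℝ] ℝ) (t • y) :=
          (hasFDerivAt_const (0 : ℝ) _).congr_of_eventuallyEq
            (Filter.Eventually.of_forall fun y => (hexp y).symm.trans (hφ0 y))
        have h3 := DFunLike.congr_fun (h1.unique h2) w
        simp only [sum_apply, smul_apply, smul_eq_mul,
          zero_apply] at h3
        calc _ = t ^ q * ∑ k, φ (B k) * fderiv ℝ (fun y => B.coord k (ρ y)) (t • y) w := by
              rw [Finset.mul_sum]
              exact Finset.sum_congr rfl fun k _ => by ring
          _ = 0 := by rw [h3, mul_zero]
    _ = 0 := intervalIntegral.integral_zero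

theorem ghostPrimitive_mem {p q : ℕ} {ρ : F → GhostAlgebra F}
    (hρ : ∀ φ : Module.Dual ℝ (GhostAlgebra F), ContDiff ℝ ∞ (fun y => φ (ρ y)))
    (hG : ∀ y, ρ y ∈ ghostBidegree F p q) (y : F) :
    ghostPrimitive q ρ y ∈ ghostBidegree F p (q + 1) :=
  sum_mem fun i _ => by
    simpa only [zero_add, add_comm 1 q] using mul_mem_ghostBidegree
      (ghostMomentum_mem_ghostBidegree _) (ghostRadialIntegral_mem hρ hG q _ y)

theorem ghostContract_ghostPrimitive {p q : ℕ} {ρ : F → GhostAlgebra F}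
    (hρ : ∀ φ : Module.Dual ℝ (GhostAlgebra F), ContDiff ℝ ∞ (fun y => φ (ρ y)))
    (hG : ∀ y, ρ y ∈ ghostBidegree F p q) (h0 : ∀ y, ghostContract y (ρ y) = 0)
    (h00 : q = 0 → ρ 0 = 0) (y : F) : ghostContract y (ghostPrimitive q ρ y) = ρ y := by
  let B := Module.finBasis ℝ (GhostAlgebra F)
  let b := Module.finBasis ℝ F
  -- An auxiliary norm from basis coordinates, used only to apply the homotopy formula; the
  -- vector-valued integral is then matched with the coefficientwise one.
  let _ : NormedAddCommGroup (GhostAlgebra F) :=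
    NormedAddCommGroup.induced _ _ B.equivFun.toLinearMap B.equivFun.injective
  let _ : NormedSpace ℝ (GhostAlgebra F) :=
    NormedSpace.induced ℝ _ _ B.equivFun.toLinearMap
  have : CompleteSpace (GhostAlgebra F) := FiniteDimensional.complete ℝ _
  let C : F →L[ℝ] GhostAlgebra F →L[ℝ] GhostAlgebra F :=
    LinearMap.toContinuousLinearMap (LinearMap.toContinuousLinearMap.toLinearMap ∘ₗ ghostContract)
  let m : Fin _ → GhostAlgebra F →L[ℝ] GhostAlgebra F := fun i =>
    LinearMap.toContinuousLinearMap (LinearMap.mulLeft ℝ (ghostMomentum (b.coord i)))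
  have hρ' : ContDiff ℝ ∞ ρ := by
    have : ρ = fun y => ∑ k, B.coord k (ρ y) • B k := funext fun y => (B.sum_repr _).symm
    rw [this]
    exact ContDiff.sum fun k _ => (hρ (B.coord k)).smul contDiff_const
  have hρ1 : ContDiff ℝ 1 ρ := hρ'.of_le (by simp)
  have key := koszul_radial_homotopy b C m
    (fun i y z => ghostContract_ghostMomentum_mul y (b.coord i) z) hρ1
    (fun y => sum_ghostMomentum_mul_ghostContract b (hG y)) h0 h00 y
  refine Eq.trans ?_ key
  change ghostContract y _ = ghostContract y _
  congr 1
  refine Finset.sum_congr rfl fun i _ => ?_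
  change ghostMomentum (b.coord i) * _ = ghostMomentum (b.coord i) * _
  congr 1
  rw [← B.sum_repr (∫ t in (0 : ℝ)..1, t ^ q • fderiv ℝ ρ (t • y) (b i))]
  refine Finset.sum_congr rfl fun k _ => ?_
  congr 1
  let β : GhostAlgebra F →L[ℝ] ℝ := LinearMap.toContinuousLinearMap (B.coord k)
  have hint : IntervalIntegrable (fun t : ℝ => t ^ q • fderiv ℝ ρ (t • y) (b i))
      MeasureTheory.volume 0 1 :=
    ((continuous_pow q).smul (((hρ1.continuous_fderiv one_ne_zero).comp
      (continuous_id.smul continuous_const)).clm_apply continuous_const)).intervalIntegrable 0 1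
  have h1 := β.intervalIntegral_comp_comm hint
  refine Eq.trans ?_ h1
  rw [radialIntegral]
  congr 1
  funext t
  rw [map_smul, smul_eq_mul]
  congr 1
  have h2 := (β.hasFDerivAt (x := ρ (t • y))).comp (t • y)
    (hρ1.differentiable one_ne_zero (t • y)).hasFDerivAt
  exact DFunLike.congr_fun h2.fderiv (b i)

end RadialIntegral

/-! ### Koszul primitives over a trivialization -/

section KoszulLocal

variable {EB : Type*} [NormedAddCommGroup EB] [NormedSpace ℝ EB]
  {S : Type*} [TopologicalSpace S] [ChartedSpace EB S] [IsManifold 𝓘(ℝ, EB) ∞ S]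
  {F : Type*} [NormedAddCommGroup F] [NormedSpace ℝ F] [FiniteDimensional ℝ F]

/-- Radial integrals in the second variable of a smooth function on `U × F` are smooth. -/
theorem contDiffOn_radialIntegral {N : Set EB} (hN : IsOpen N) {H : EB × F → ℝ}
    (hH : ContDiffOn ℝ ∞ H (N ×ˢ Set.univ)) (q : ℕ) (w : F) :
    ContDiffOn ℝ ∞ (fun z : EB × F => radialIntegral q w (fun y => H (z.1, y)) z.2)
      (N ×ˢ Set.univ) := by
  have hopen : IsOpen (N ×ˢ (Set.univ : Set F)) := hN.prod isOpen_univ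
  have hd : ContDiffOn ℝ ∞ (fun z => fderiv ℝ H z ((0 : EB), w)) (N ×ˢ Set.univ) :=
    (hH.fderiv_of_isOpen hopen (by simp)).clm_apply contDiffOn_const
  have hG : ContDiffOn ℝ ∞ (fun z : (EB × F) × ℝ => z.2 ^ q *
      fderiv ℝ H (z.1.1, z.2 • z.1.2) ((0 : EB), w)) ((N ×ˢ Set.univ) ×ˢ Set.univ) := by
    refine (contDiff_snd.pow q).contDiffOn.mul ?_
    have h1 : ContDiff ℝ ∞ (fun z : (EB × F) × ℝ => (z.1.1, z.2 • z.1.2)) :=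
      contDiff_fst.fst.prodMk (contDiff_snd.smul contDiff_fst.snd)
    exact hd.comp h1.contDiffOn fun z hz => ⟨hz.1.1, trivial⟩
  refine (contDiffOn_parametric_unitInterval hopen (G := fun z t => t ^ q *
      fderiv ℝ H (z.1, t • z.2) ((0 : EB), w)) hG).congr fun z hz => ?_
  rw [radialIntegral]
  congr 1
  funext t
  congr 1
  have h1 : HasFDerivAt H (fderiv ℝ H (z.1, t • z.2)) (z.1, t • z.2) :=
    ((hH.contDiffAt (x := (z.1, t • z.2)) (hopen.mem_nhds ⟨hz.1, trivial⟩)).differentiableAt (by simp)).hasFDerivAt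
  have h2 := h1.comp (t • z.2) (hasFDerivAt_prodMk_right z.1 (t • z.2))
  have h3 := DFunLike.congr_fun h2.fderiv w
  exact h3

theorem contMDiffOn_prod_iff_contDiffOn {f : EB × F → ℝ} {s : Set (EB × F)} :
    ContMDiffOn (𝓘(ℝ, EB).prod 𝓘(ℝ, F)) 𝓘(ℝ, ℝ) ∞ f s ↔ ContDiffOn ℝ ∞ f s := by
  rw [← contMDiffOn_iff_contDiffOn, modelWithCornersSelf_prod]
  have h := chartedSpaceSelf_prod (H := EB) (H' := F)
  rw [← h]

/-- A chart is taken in the base only. The fibre stays all of `F`, so the segment from `0` to the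
point never leaves the domain. -/
theorem contMDiffOn_radialIntegral {U : Set S} (hU : IsOpen U) {H : S × F → ℝ}
    (hH : ContMDiffOn (𝓘(ℝ, EB).prod 𝓘(ℝ, F)) 𝓘(ℝ, ℝ) ∞ H (U ×ˢ Set.univ)) (q : ℕ) (w : F) :
    ContMDiffOn (𝓘(ℝ, EB).prod 𝓘(ℝ, F)) 𝓘(ℝ, ℝ) ∞
      (fun z : S × F => radialIntegral q w (fun y => H (z.1, y)) z.2) (U ×ˢ Set.univ) := by
  rintro ⟨x₀, y₀⟩ ⟨hx₀, -⟩
  let c := chartAt EB x₀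
  let N : Set EB := c.target ∩ c.symm ⁻¹' U
  have hN : IsOpen N := c.isOpen_inter_preimage_symm hU
  have hHc : ContDiffOn ℝ ∞ (fun z : EB × F => H (c.symm z.1, z.2)) (N ×ˢ Set.univ) := by
    rw [← contMDiffOn_prod_iff_contDiffOn]
    refine hH.comp (t := U ×ˢ Set.univ) ?_ fun z hz => ⟨hz.1.2, trivial⟩
    refine ContMDiffOn.prodMk ?_ contMDiffOn_snd
    exact (contMDiffOn_chart_symm (I := 𝓘(ℝ, EB)) (x := x₀)).comp contMDiffOn_fst
      fun z hz => hz.1.1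
  have hR := contDiffOn_radialIntegral hN hHc q w
  rw [← contMDiffOn_prod_iff_contDiffOn] at hR
  have hxs : x₀ ∈ c.source := mem_chart_source EB x₀
  have hmem : (c x₀, y₀) ∈ N ×ˢ (Set.univ : Set F) :=
    ⟨⟨c.map_source hxs, by rw [Set.mem_preimage, c.left_inv hxs]; exact hx₀⟩, trivial⟩
  have hR' := (hR.contMDiffAt ((hN.prod isOpen_univ).mem_nhds hmem))
  have hc : ContMDiffAt (𝓘(ℝ, EB).prod 𝓘(ℝ, F)) (𝓘(ℝ, EB).prod 𝓘(ℝ, F)) ∞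
      (fun z : S × F => (c z.1, z.2)) (x₀, y₀) := by
    refine ContMDiffAt.prodMk ?_ contMDiffAt_snd
    exact ((contMDiffOn_chart (I := 𝓘(ℝ, EB)) (x := x₀)).contMDiffAt
      (c.open_source.mem_nhds hxs)).comp (x₀, y₀) contMDiffAt_fst
  refine ((hR'.comp (x₀, y₀) hc).congr_of_eventuallyEq ?_).contMDiffWithinAt
  have hev : ∀ᶠ z : S × F in nhds (x₀, y₀), z.1 ∈ c.source :=
    continuousAt_fst.preimage_mem_nhds (c.open_source.mem_nhds hxs)
  filter_upwards [hev] with z hz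
  simp only [Function.comp_apply, c.left_inv hz]

variable {V : S → Type*} [∀ x, AddCommGroup (V x)] [∀ x, Module ℝ (V x)]
  [TopologicalSpace (TotalSpace F V)] [∀ x, TopologicalSpace (V x)]
  [FiberBundle F V] [VectorBundle ℝ F V] [ContMDiffVectorBundle ∞ F V 𝓘(ℝ, EB)]

variable (e : Trivialization F (π F V)) [MemTrivializationAtlas e]

/-- The coordinates of a section of `⋀𝓔 ⊗ ⋀𝓔*` along the fibre of `E` over `x`. -/
noncomputable def ghostFibreCoord (R : BFV EB F V) (x : S) (y : F) : GhostAlgebra F :=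
  ghostCoord e x (R.1 ⟨x, e.symmₗ ℝ x y⟩)

theorem contMDiffOn_ghostFibreCoord (R : BFV EB F V) (φ : Module.Dual ℝ (GhostAlgebra F)) :
    ContMDiffOn (𝓘(ℝ, EB).prod 𝓘(ℝ, F)) 𝓘(ℝ, ℝ) ∞
      (fun z : S × F => φ (ghostFibreCoord e R z.1 z.2)) (e.baseSet ×ˢ Set.univ) := by
  have h1 : ContMDiffOn (𝓘(ℝ, EB).prod 𝓘(ℝ, F)) 𝓘(ℝ, ℝ) ∞
      (fun v : TotalSpace F V => φ (ghostCoord e v.proj (R.1 v))) e.source := fun v hv =>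
    (IsSmoothGhostSection.isSmoothGhostAt e R.2 (e.mem_source.1 hv) φ).contMDiffWithinAt
  have h2 := e.contMDiffOn_symm (IB := 𝓘(ℝ, EB)) (n := ∞)
  rw [e.target_eq] at h2
  refine (h1.comp h2 fun z hz => ?_).congr fun z hz => ?_
  · exact e.map_target (e.target_eq ▸ hz)
  · have : e.toOpenPartialHomeomorph.symm z = ⟨z.1, e.symmₗ ℝ z.1 z.2⟩ := by
      rw [e.symmₗ_apply hz.1, e.mk_symm hz.1]
    rw [Function.comp_apply, this]
    rfl

theorem contDiff_ghostFibreCoord (R : BFV EB F V) {x : S} (hx : x ∈ e.baseSet)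
    (φ : Module.Dual ℝ (GhostAlgebra F)) :
    ContDiff ℝ ∞ (fun y => φ (ghostFibreCoord e R x y)) := by
  rw [← contMDiff_iff_contDiff, ← contMDiffOn_univ]
  refine (contMDiffOn_ghostFibreCoord e R φ).comp (t := e.baseSet ×ˢ Set.univ)
    (f := fun y : F => (x, y)) ?_ fun y _ => ⟨hx, trivial⟩
  exact (contMDiff_const.prodMk contMDiff_id).contMDiffOn

theorem isSmoothGhostAt_ghostPrimitive (R : BFV EB F V) (q : ℕ) {v₀ : TotalSpace F V}
    (h : v₀.proj ∈ e.baseSet) :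
    IsSmoothGhostAt EB (fun v => ghostPrimitive q (ghostFibreCoord e R v.proj)
      (e.linearMapAt ℝ v.proj v.snd)) v₀ := by
  refine IsSmoothGhostAt.sum fun i _ => (isSmoothGhostAt_const _ _).mul ?_
  refine IsSmoothGhostAt.sum fun k _ => (isSmoothGhostAt_const _ _).smul ?_
  have h1 := contMDiffOn_radialIntegral e.open_baseSet (contMDiffOn_ghostFibreCoord e R
    ((Module.finBasis ℝ (GhostAlgebra F)).coord k)) q (Module.finBasis ℝ F i)
  have h2 : ContMDiffAt (𝓘(ℝ, EB).prod 𝓘(ℝ, F)) (𝓘(ℝ, EB).prod 𝓘(ℝ, F)) ∞ e v₀ :=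
    (e.contMDiffOn (IB := 𝓘(ℝ, EB)) (n := ∞)).contMDiffAt
      (e.open_source.mem_nhds (e.mem_source.2 h))
  have h3 := (h1.contMDiffAt (x := e v₀) ((e.open_baseSet.prod isOpen_univ).mem_nhds
    ⟨by rw [e.coe_fst (e.mem_source.2 h)]; exact h, trivial⟩)).comp v₀ h2
  refine h3.congr_of_eventuallyEq ?_
  filter_upwards [preimage_baseSet_mem_nhds e h] with v hv
  simp only [Function.comp_apply, e.coe_fst (e.mem_source.2 hv), e.coe_linearMapAt_of_mem hv]

/-- The radial primitive of a section in a local trivialization, multiplied by a cutoff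
function. -/
theorem exists_local_koszul_primitive {R : BFV EB F V} {p q : ℕ}
    (hR : R ∈ bfvBidegree EB F V p q) (h0 : ∀ v, ghostContract v.snd (R.1 v) = 0)
    (h00 : q = 0 → ∀ x : S, R.1 (zeroSection F V x) = 0)
    {χ : S → ℝ} (hχ : ContMDiff 𝓘(ℝ, EB) 𝓘(ℝ, ℝ) ∞ χ) (hsupp : tsupport χ ⊆ e.baseSet) :
    ∃ X ∈ bfvBidegree EB F V p (q + 1),
      (∀ v, ghostContract v.snd (X.1 v) = χ v.proj • R.1 v) ∧
      ∀ v, χ v.proj = 0 → X.1 v = 0 := by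
  have hzero : ∀ x : S, e.symmₗ ℝ x 0 = 0 := fun x => map_zero _
  refine ⟨⟨fun v => χ v.proj • ghostOfCoord e v.proj (ghostPrimitive q
      (ghostFibreCoord e R v.proj) (e.linearMapAt ℝ v.proj v.snd)),
    isSmoothGhostSection_cutoff e hχ hsupp fun v hv => isSmoothGhostAt_ghostPrimitive e R q hv⟩,
    fun v => ?_, fun v => ?_, fun v hv => ?_⟩
  · change χ v.proj • ghostOfCoord e v.proj _ ∈ _
    by_cases hv : χ v.proj = 0
    · rw [hv, zero_smul]; exact zero_mem _
    have hb : v.proj ∈ e.baseSet := hsupp (subset_tsupport _ hv)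
    exact Submodule.smul_mem _ _ (ghostMap_mem_ghostBidegree _ _ (ghostPrimitive_mem
      (contDiff_ghostFibreCoord e R hb) (fun y => ghostMap_mem_ghostBidegree _ _ (hR ⟨v.proj, e.symmₗ ℝ v.proj y⟩)) _))
  · change ghostContract v.snd (χ v.proj • ghostOfCoord e v.proj _) = _
    by_cases hv : χ v.proj = 0
    · rw [hv, zero_smul, zero_smul, map_zero]
    have hb : v.proj ∈ e.baseSet := hsupp (subset_tsupport _ hv)
    have hs : e.symmₗ ℝ v.proj (e.linearMapAt ℝ v.proj v.snd) = v.snd :=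
      e.symmₗ_linearMapAt hb v.snd
    have hk := ghostContract_ghostPrimitive (p := p) (q := q)
      (contDiff_ghostFibreCoord e R hb) (fun y => ghostMap_mem_ghostBidegree _ _ (hR ⟨v.proj, e.symmₗ ℝ v.proj y⟩))
      (fun y => by
        have h1 := congrArg (ghostCoord e v.proj) (h0 ⟨v.proj, e.symmₗ ℝ v.proj y⟩)
        rw [ghostCoord_ghostContract e hb, map_zero, e.linearMapAt_symmₗ hb] at h1
        exact h1)
      (fun hq => by
        have h1 := h00 hq v.proj
        rw [ghostFibreCoord, hzero]
        exact (congrArg (ghostCoord e v.proj) h1).trans (map_zero _))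
      (e.linearMapAt ℝ v.proj v.snd)
    rw [map_smul]
    congr 1
    have h2 := ghostOfCoord_ghostContract e hb (e.linearMapAt ℝ v.proj v.snd)
      (ghostPrimitive q (ghostFibreCoord e R v.proj) (e.linearMapAt ℝ v.proj v.snd))
    rw [hs, hk] at h2
    refine h2.symm.trans ?_
    -- The vector occurs inside a dependent argument of `R`, so it is generalized before being
    -- identified with `v.snd`.
    have h3 : ∀ w : V v.proj, w = v.snd → ghostOfCoord e v.proj
        (ghostCoord e v.proj (R.1 ⟨v.proj, w⟩)) = R.1 v := by
      rintro w rfl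
      exact ghostOfCoord_ghostCoord e hb _
    exact h3 _ hs
  · change χ v.proj • _ = _
    rw [hv, zero_smul]

end KoszulLocal

/-! ### Gluing Koszul primitives -/

section KoszulGlobal

variable {EB : Type*} [NormedAddCommGroup EB] [NormedSpace ℝ EB] [FiniteDimensional ℝ EB]
  {S : Type*} [TopologicalSpace S] [T2Space S] [SecondCountableTopology S]
  [ChartedSpace EB S] [IsManifold 𝓘(ℝ, EB) ∞ S]
  {F : Type*} [NormedAddCommGroup F] [NormedSpace ℝ F] [FiniteDimensional ℝ F]
  {V : S → Type*} [∀ x, AddCommGroup (V x)] [∀ x, Module ℝ (V x)]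
  [TopologicalSpace (TotalSpace F V)] [∀ x, TopologicalSpace (V x)]
  [FiberBundle F V] [VectorBundle ℝ F V] [ContMDiffVectorBundle ∞ F V 𝓘(ℝ, EB)]

theorem isSmoothGhostSection_finsum {ι : Type*} {X : ι → BFV EB F V}
    (hlf : LocallyFinite fun j => {v | (X j).1 v ≠ 0}) :
    IsSmoothGhostSection EB F V (fun v => ∑ᶠ j, (X j).1 v) := by
  intro v₀ φ
  let L : ∀ v : TotalSpace F V, GhostAlgebra (V v.proj) →ₗ[ℝ] ℝ := fun v => φ ∘ₗ
    (ghostMap ((trivializationAt F V v₀.proj).linearMapAt ℝ v.proj)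
          ((trivializationAt F V v₀.proj).symmₗ ℝ v.proj)).toLinearMap
  have h1 : ContMDiffAt (𝓘(ℝ, EB).prod 𝓘(ℝ, F)) 𝓘(ℝ, ℝ) ∞
      (fun v => ∑ᶠ j, L v ((X j).1 v)) v₀ := by
    refine contMDiffAt_finsum ?_ fun j => (X j).2 v₀ φ
    refine hlf.subset fun j v hv hz => hv ?_
    simp only [hz, map_zero]
  refine h1.congr_of_eventuallyEq (Filter.Eventually.of_forall fun v => ?_)
  exact (L v).toAddMonoidHom.map_finsum (hlf.point_finite v)

/-- Exactness of the Koszul complex of the tautological section. -/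
theorem exists_koszul_primitive {R : BFV EB F V} {p q : ℕ}
    (hR : R ∈ bfvBidegree EB F V p q) (h0 : ∀ v, ghostContract v.snd (R.1 v) = 0)
    (h00 : q = 0 → ∀ x : S, R.1 (zeroSection F V x) = 0) :
    ∃ Y ∈ bfvBidegree EB F V p (q + 1), ∀ v, ghostContract v.snd (Y.1 v) = R.1 v := by
  have : LocallyCompactSpace S := Manifold.locallyCompact_of_finiteDimensional 𝓘(ℝ, EB)
  -- A partition of unity on `S` suffices, since local primitives live on whole fibres. Contraction
  -- is linear at each point, so the weighted primitives add up to a primitive of `(∑ χ j) R = R`.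
  obtain ⟨χ, hχ⟩ := SmoothPartitionOfUnity.exists_isSubordinate 𝓘(ℝ, EB) isClosed_univ
    (fun x : S => (trivializationAt F V x).baseSet)
    (fun x => (trivializationAt F V x).open_baseSet)
    (fun x _ => Set.mem_iUnion.2 ⟨x, mem_baseSet_trivializationAt F V x⟩)
  choose X hX hXR hX0 using fun j : S => exists_local_koszul_primitive
    (trivializationAt F V j) hR h0 h00 (χ j).contMDiff (hχ j)
  have hlf : LocallyFinite fun j => {v | (X j).1 v ≠ 0} :=
    (χ.locallyFinite.preimage_continuous (FiberBundle.continuous_proj F V)).subset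
      fun j v hv hz => hv (hX0 j v hz)
  refine ⟨⟨fun v => ∑ᶠ j, (X j).1 v, isSmoothGhostSection_finsum hlf⟩, fun v => ?_, fun v => ?_⟩
  · exact finsum_induction (fun z => z ∈ ghostBidegree (V v.proj) p (q + 1)) (zero_mem _)
      (fun _ _ => add_mem) fun j => hX j v
  · change ghostContract v.snd (∑ᶠ j, (X j).1 v) = R.1 v
    rw [← LinearMap.toAddMonoidHom_coe, AddMonoidHom.map_finsum _ (hlf.point_finite v)]
    simp only [LinearMap.toAddMonoidHom_coe, hXR]
    rw [← finsum_smul, χ.sum_eq_one (Set.mem_univ _), one_smul]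

end KoszulGlobal

/-! ### Functions vanishing on the zero section -/

section Coisotropic

variable {EB : Type*} [NormedAddCommGroup EB] [NormedSpace ℝ EB]
  {S : Type*} [TopologicalSpace S] [ChartedSpace EB S] [IsManifold 𝓘(ℝ, EB) ∞ S]
  {F : Type*} [NormedAddCommGroup F] [NormedSpace ℝ F]
  {V : S → Type*} [∀ x, AddCommGroup (V x)] [∀ x, Module ℝ (V x)]
  [TopologicalSpace (TotalSpace F V)] [∀ x, TopologicalSpace (V x)]
  [FiberBundle F V] [VectorBundle ℝ F V] [ContMDiffVectorBundle ∞ F V 𝓘(ℝ, EB)]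

/-- By the chain rule for `f ∘ zeroSection = 0`, the differential is conormal to `S`. -/
theorem covectorOf_mfderiv_zeroSection {f : TotalSpace F V → ℝ}
    (hf : ContMDiff (𝓘(ℝ, EB).prod 𝓘(ℝ, F)) 𝓘(ℝ, ℝ) ∞ f) (h0 : ∀ x, f (zeroSection F V x) = 0)
    (x : S) (u : TangentSpace 𝓘(ℝ, EB) x) :
    covectorOf (𝓘(ℝ, EB).prod 𝓘(ℝ, F)) f (zeroSection F V x)
      (mfderiv 𝓘(ℝ, EB) (𝓘(ℝ, EB).prod 𝓘(ℝ, F)) (zeroSection F V) x u) = 0 := by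
  have h1 : MDifferentiableAt 𝓘(ℝ, EB) (𝓘(ℝ, EB).prod 𝓘(ℝ, F)) (zeroSection F V) x :=
    ((contMDiff_zeroSection (n := ∞) ℝ V) x).mdifferentiableAt (by simp)
  have h2 : MDifferentiableAt (𝓘(ℝ, EB).prod 𝓘(ℝ, F)) 𝓘(ℝ, ℝ) f (zeroSection F V x) :=
    (hf _).mdifferentiableAt (by simp)
  have h3 := mfderiv_comp x h2 h1
  have h4 : f ∘ zeroSection F V = fun _ => 0 := funext h0
  rw [h4, mfderiv_const] at h3
  exact (DFunLike.congr_fun h3 u).symm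

/-- Functions vanishing on a coisotropic zero section Poisson commute there. -/
theorem PoissonStructure.IsCoisotropic.bracket_eq_zero
    {P : PoissonStructure (𝓘(ℝ, EB).prod 𝓘(ℝ, F)) (TotalSpace F V)}
    (hP : P.IsCoisotropic 𝓘(ℝ, EB) (zeroSection F V)) {f g : TotalSpace F V → ℝ}
    (hf : ContMDiff (𝓘(ℝ, EB).prod 𝓘(ℝ, F)) 𝓘(ℝ, ℝ) ∞ f)
    (hg : ContMDiff (𝓘(ℝ, EB).prod 𝓘(ℝ, F)) 𝓘(ℝ, ℝ) ∞ g)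
    (hf0 : ∀ x, f (zeroSection F V x) = 0) (hg0 : ∀ x, g (zeroSection F V x) = 0) (x : S) :
    P.bracket f g (zeroSection F V x) = 0 := by
  obtain ⟨u, hu⟩ := hP x (covectorOf _ f (zeroSection F V x))
    (covectorOf_mfderiv_zeroSection hf hf0 x)
  rw [PoissonStructure.bracket, sharpBracket, ← hu]
  exact covectorOf_mfderiv_zeroSection hg hg0 x u

end Coisotropic

/-- The form the graded Jacobi identity takes for `T = [Ω, [Ω, Ω]]` with Ω odd; it says `3T = 0`. -/
theorem eq_zero_of_eq_neg_add_neg {M : Type*} [AddCommGroup M] [Module ℝ M] {T : M}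
    (h : T = -T + -T) : T = 0 := by
  have h3 : T + T + T = 0 := by
    nth_rewrite 1 [h]
    abel
  calc T = (1 / 3 : ℝ) • (T + T + T) := by module
    _ = 0 := by rw [h3, smul_zero]

/-! ### Inductive construction of the charge -/

section Charge

variable {EB : Type*} [NormedAddCommGroup EB] [NormedSpace ℝ EB] [FiniteDimensional ℝ EB]
  {S : Type*} [TopologicalSpace S] [T2Space S]
  [ChartedSpace EB S] [IsManifold 𝓘(ℝ, EB) ∞ S]
  {F : Type*} [NormedAddCommGroup F] [NormedSpace ℝ F] [FiniteDimensional ℝ F]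
  {V : S → Type*} [∀ x, AddCommGroup (V x)] [∀ x, Module ℝ (V x)]
  [TopologicalSpace (TotalSpace F V)] [∀ x, TopologicalSpace (V x)]
  [FiberBundle F V] [VectorBundle ℝ F V]

theorem bfvTautological_mem_bfvBidegree :
    bfvTautological EB F V ∈ bfvBidegree EB F V 1 0 := fun v => ghost_mem_ghostBidegree v.snd

theorem bfvTautological_mem_bfvDegree :
    bfvTautological EB F V ∈ bfvDegree EB F V 1 :=
  mem_bfvDegree_of_mem_bfvBidegree (by simp) bfvTautological_mem_bfvBidegree

theorem mem_bfvDegree_of_eq_ghostMomentum {Y : BFV EB F V}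
    {α : ∀ v : TotalSpace F V, Module.Dual ℝ (V v.proj)}
    (hY : ∀ v, Y.1 v = ghostMomentum (α v)) : Y ∈ bfvDegree EB F V (-1) :=
  mem_bfvDegree_of_mem_bfvBidegree (p := 0) (q := 1) (by simp) fun v => by
    rw [hY]; exact ghostMomentum_mem_ghostBidegree _

theorem isPointDerivation_ghostContract (v : TotalSpace F V) :
    IsPointDerivation v 1 (ghostContract v.snd ∘ₗ (bfvEval EB v).toLinearMap) := by
  intro k X Y hX
  simp only [LinearMap.comp_apply, AlgHom.toLinearMap_apply, map_mul, ghostContract_mul, one_mul]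
  change _ + ghostInvolute (V v.proj) (X.1 v) * _ = _
  rw [ghostInvolute_of_mem_bfvDegree hX, smul_mul_assoc]
  rfl

theorem IsPointDerivation.sub {v : TotalSpace F V} {d : ℤ}
    {D D' : BFV EB F V →ₗ[ℝ] GhostAlgebra (V v.proj)} (hD : IsPointDerivation v d D)
    (hD' : IsPointDerivation v d D') : IsPointDerivation v d (D - D') := by
  intro k X Y hX
  rw [LinearMap.sub_apply, LinearMap.sub_apply, LinearMap.sub_apply, hD k X Y hX, hD' k X Y hX,
    sub_mul, mul_sub, smul_sub]
  abel

variable {br : BFV EB F V →ₗ[ℝ] BFV EB F V →ₗ[ℝ] BFV EB F V}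

theorem IsGradedPoissonBracket.isPointDerivation
    (hbr : IsGradedPoissonBracket (bfvDegree EB F V) br) {d : ℤ} {X : BFV EB F V}
    (hX : X ∈ bfvDegree EB F V d) (v : TotalSpace F V) :
    IsPointDerivation v d ((bfvEval EB v).toLinearMap ∘ₗ br X) := by
  intro k Y Z hY
  simp only [LinearMap.comp_apply, AlgHom.toLinearMap_apply, hbr.leibniz d k X Y Z hX hY,
    map_add, map_mul, map_zsmul]
  rfl

variable [ContMDiffVectorBundle ∞ F V 𝓘(ℝ, EB)]

theorem IsGradedPoissonBracket.mem_bfvGE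
    (hbr : IsGradedPoissonBracket (bfvDegree EB F V) br) {d : ℤ} {X : BFV EB F V}
    (hX : X ∈ bfvDegree EB F V d)
    (hmom : ∀ (Y : BFV EB F V) (α : ∀ v : TotalSpace F V, Module.Dual ℝ (V v.proj)),
      (∀ v, Y.1 v = ghostMomentum (α v)) → br X Y ∈ bfvGE EB F V 1)
    {q : ℕ} {Y : BFV EB F V} (hY : Y ∈ bfvGE EB F V q) : br X Y ∈ bfvGE EB F V q := fun v =>
  (hbr.isPointDerivation hX v).mem_ghostGE (fun Y α hα => hmom Y α hα v) hY

/-- The bracket of two momenta has degree `-2`, so each of its components contains a momentum, as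
the criterion for point derivations requires. -/
theorem IsGradedPoissonBracket.momentum_mem_bfvGE
    (hbr : IsGradedPoissonBracket (bfvDegree EB F V) br) {X : BFV EB F V}
    {β : ∀ v : TotalSpace F V, Module.Dual ℝ (V v.proj)} (hX : ∀ v, X.1 v = ghostMomentum (β v))
    {q : ℕ} {Y : BFV EB F V} (hY : Y ∈ bfvGE EB F V q) : br X Y ∈ bfvGE EB F V q := by
  refine hbr.mem_bfvGE (mem_bfvDegree_of_eq_ghostMomentum hX) (fun Y α hα => ?_) hY
  exact mem_bfvGE_of_mem_bfvDegree (by norm_num)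
    (hbr.degree _ _ _ _ (mem_bfvDegree_of_eq_ghostMomentum hX)
      (mem_bfvDegree_of_eq_ghostMomentum hα))

/-- An element of degree `1` of `BFV_{≥ 1}` acts on the filtration without lowering it. -/
theorem IsGradedPoissonBracket.mem_bfvGE_of_mem_bfvGE_one
    (hbr : IsGradedPoissonBracket (bfvDegree EB F V) br) {Z : BFV EB F V}
    (hZ : Z ∈ bfvDegree EB F V 1) (hZ1 : Z ∈ bfvGE EB F V 1) {q : ℕ} {Y : BFV EB F V}
    (hY : Y ∈ bfvGE EB F V q) : br Z Y ∈ bfvGE EB F V q := by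
  refine hbr.mem_bfvGE hZ (fun Y α hα => ?_) hY
  rw [hbr.skew _ _ _ _ hZ (mem_bfvDegree_of_eq_ghostMomentum hα)]
  exact neg_mem (Submodule.smul_of_tower_mem _ _ (hbr.momentum_mem_bfvGE hα hZ1))

/-- The leading term of `[Ω, -]` is the Koszul differential. -/
theorem IsBFVBracket.bracket_sub_ghostContract_mem
    {P : PoissonStructure (𝓘(ℝ, EB).prod 𝓘(ℝ, F)) (TotalSpace F V)} (hbr : IsBFVBracket P br)
    {Ω : BFV EB F V} (hΩ : Ω ∈ bfvDegree EB F V 1)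
    (hΩ1 : Ω - bfvTautological EB F V ∈ bfvGE EB F V 1) {q : ℕ} {Y : BFV EB F V}
    (hY : Y ∈ bfvGE EB F V q) (v : TotalSpace F V) :
    (br Ω Y).1 v - ghostContract v.snd (Y.1 v) ∈ ghostGE (V v.proj) q := by
  have hg := hbr.isGradedPoisson
  -- The difference is again a point derivation, so only momenta `α` remain. There `[Ω - Ω₀, α]`
  -- lies in `BFV_{≥ 1}`, and `[Ω₀, α]` has degree `0` with scalar part the pairing, which is the
  -- contraction of `α`.
  refine ((hg.isPointDerivation hΩ v).sub (isPointDerivation_ghostContract v)).mem_ghostGE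
    (fun Y α hα => ?_) hY
  change (br Ω Y).1 v - ghostContract v.snd (Y.1 v) ∈ _
  have h1 : br (Ω - bfvTautological EB F V) Y ∈ bfvGE EB F V 1 := by
    have hd : Ω - bfvTautological EB F V ∈ bfvDegree EB F V 1 :=
      sub_mem hΩ bfvTautological_mem_bfvDegree
    rw [hg.skew _ _ _ _ hd (mem_bfvDegree_of_eq_ghostMomentum hα)]
    exact neg_mem (Submodule.smul_of_tower_mem _ _ (hg.momentum_mem_bfvGE hα hΩ1))
  have hd : br (bfvTautological EB F V) Y ∈ bfvDegree EB F V 0 := by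
    simpa only [add_neg_cancel] using hg.degree 1 (-1) _ _
      bfvTautological_mem_bfvDegree (mem_bfvDegree_of_eq_ghostMomentum hα)
  have h2 := sub_algebraMap_mem_ghostGE_one hd v
  rw [hbr.pairing (bfvTautological EB F V) Y (fun v => v.snd) α (fun _ => rfl) hα] at h2
  rw [hα, ghostContract_ghostMomentum]
  have h4 : br Ω Y = br (Ω - bfvTautological EB F V) Y + br (bfvTautological EB F V) Y := by
    rw [map_sub, LinearMap.sub_apply, sub_add_cancel]
  have h5 : (br Ω Y).1 v = (br (Ω - bfvTautological EB F V) Y).1 v +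
      (br (bfvTautological EB F V) Y).1 v := by
    rw [h4]; rfl
  rw [h5, add_sub_assoc]
  exact add_mem (h1 v) h2

/-- Near a point of the zero section, the tautological section is a combination of fibre
coordinates: a point derivation of `BFV(E)` there is controlled on it by its values on
functions vanishing on the zero section. -/
theorem exists_fibre_coordinates (x : S) :
    ∃ (n : ℕ) (f : Fin n → C^∞⟮𝓘(ℝ, EB).prod 𝓘(ℝ, F), TotalSpace F V; 𝓘(ℝ, ℝ), ℝ⟯),
      (∀ i y, f i (zeroSection F V y) = 0) ∧
      ∀ (d : ℤ) (D : BFV EB F V →ₗ[ℝ] GhostAlgebra (V (zeroSection F V x).proj)),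
        IsPointDerivation (zeroSection F V x) d D →
        (∀ i, D (bfvOfFun (f i)) ∈ ghostGE (V (zeroSection F V x).proj) 1) →
        D (bfvTautological EB F V) ∈ ghostGE (V (zeroSection F V x).proj) 1 := by
  set e := trivializationAt F V x with he
  obtain ⟨χ, χ', hχ, hχ', hs, hs', h1, hχχ'⟩ := exists_nested_cutoffs (EB := EB) e.open_baseSet
    (mem_baseSet_trivializationAt F V x)
  let κ := bfvFrame e hχ hs
  let b := Module.finBasis ℝ F
  have hsm : ∀ i, ∀ v : TotalSpace F V, v.proj ∈ e.baseSet →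
      ContMDiffAt (𝓘(ℝ, EB).prod 𝓘(ℝ, F)) 𝓘(ℝ, ℝ) ∞
        (fun v : TotalSpace F V => b.coord i (e.linearMapAt ℝ v.proj v.snd)) v := by
    intro i v hv
    have h2 : ContMDiffAt (𝓘(ℝ, EB).prod 𝓘(ℝ, F)) (𝓘(ℝ, EB).prod 𝓘(ℝ, F)) ∞ e v :=
      (e.contMDiffOn (IB := 𝓘(ℝ, EB)) (n := ∞)).contMDiffAt
        (e.open_source.mem_nhds (e.mem_source.2 hv))
    have h3 := (LinearMap.toContinuousLinearMap (b.coord i)).contMDiff (n := ∞)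
      |>.contMDiffAt (x := (e v).2) |>.comp v h2.snd
    refine h3.congr_of_eventuallyEq ?_
    filter_upwards [preimage_baseSet_mem_nhds e hv] with v hv
    simp [e.coe_linearMapAt_of_mem hv]
  let f : Fin _ → C^∞⟮𝓘(ℝ, EB).prod 𝓘(ℝ, F), TotalSpace F V; 𝓘(ℝ, ℝ), ℝ⟯ := fun i =>
    ⟨fun v => χ' v.proj * b.coord i (e.linearMapAt ℝ v.proj v.snd),
      contMDiff_cutoff e hχ' hs' (hsm i)⟩
  let g : C^∞⟮𝓘(ℝ, EB).prod 𝓘(ℝ, F), TotalSpace F V; 𝓘(ℝ, ℝ), ℝ⟯ :=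
    ⟨fun w => χ' w.proj, contMDiffAt_comp_proj hχ'⟩
  have hf0 : ∀ i y, f i (zeroSection F V y) = 0 := fun i y => by
    change χ' y * b.coord i (e.linearMapAt ℝ y (0 : V y)) = 0
    rw [map_zero, map_zero, mul_zero]
  refine ⟨_, f, hf0, fun d D hD hDf => ?_⟩
  have hsum : bfvOfFun g * bfvTautological EB F V = ∑ i, bfvOfFun (f i) * κ (ghost (b i)) := by
    refine Subtype.ext <| funext fun w => ?_
    have e1 : (bfvOfFun g * bfvTautological EB F V).1 w = χ' w.proj • ghost w.snd :=
      (Algebra.smul_def (χ' w.proj) (ghost w.snd)).symm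
    have e2 : (∑ i, bfvOfFun (f i) * κ (ghost (b i))).1 w =
        ∑ i, (χ' w.proj * b.coord i (e.linearMapAt ℝ w.proj w.snd)) •
          (κ (ghost (b i))).1 w := by
      rw [← bfvEval_apply, map_sum]
      exact Finset.sum_congr rfl fun i _ => (Algebra.smul_def
        (χ' w.proj * b.coord i (e.linearMapAt ℝ w.proj w.snd)) ((κ (ghost (b i))).1 w)).symm
    rw [e1, e2]
    by_cases hw : χ' w.proj = 0
    · simp [hw]
    · have hb : w.proj ∈ e.baseSet := hs' (subset_tsupport _ hw)
      simp only [κ, bfvFrame_ghost, hχχ' _ hw, one_smul, mul_smul, ← Finset.smul_sum]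
      congr 1
      conv_lhs => rw [← e.symmₗ_linearMapAt (R := ℝ) hb w.snd,
        ← b.sum_repr (e.linearMapAt ℝ w.proj w.snd)]
      simp only [map_sum, map_smul]
      rfl
  -- On the zero section both `Ω₀` and the `f i` vanish, so the Leibniz rule leaves only terms
  -- containing `D(f i)`.
  have h2 := congrArg D hsum
  have hg : g (zeroSection F V x) = 1 := h1
  have hΩ : (bfvTautological EB F V).1 (zeroSection F V x) = 0 := map_zero ghost
  rw [hD.ofFun_mul, map_sum, hg, one_smul, hΩ, mul_zero, zero_add] at h2
  rw [h2]
  refine sum_mem fun i _ => ?_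
  rw [hD.ofFun_mul, hf0, zero_smul, add_zero]
  exact mul_mem_ghostGE_left (hDf i) _

/-- The obstruction to `[Ω₀, Ω₀] = 0` vanishes on a coisotropic zero section. -/
theorem IsBFVBracket.tautological_bracket_mem
    {P : PoissonStructure (𝓘(ℝ, EB).prod 𝓘(ℝ, F)) (TotalSpace F V)}
    (hP : P.IsCoisotropic 𝓘(ℝ, EB) (zeroSection F V)) (hbr : IsBFVBracket P br) (x : S) :
    (br (bfvTautological EB F V) (bfvTautological EB F V)).1 (zeroSection F V x) ∈
      ghostGE (V (zeroSection F V x).proj) 1 := by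
  have hg := hbr.isGradedPoisson
  obtain ⟨n, f, hf0, hf⟩ := exists_fibre_coordinates (EB := EB) (F := F) (V := V) x
  have h : ∀ i, (br (bfvOfFun (f i)) (bfvTautological EB F V)).1 (zeroSection F V x) ∈
      ghostGE (V (zeroSection F V x).proj) 1 := by
    -- Coordinates are used twice: `[f i, -]` reduces `[f i, Ω₀]` to `[f i, f j]`, whose scalar part
    -- vanishes by coisotropy; then `[Ω₀, -]` reduces `[Ω₀, Ω₀]` to `[Ω₀, f i]`.
    refine fun i => hf 0 _ (hg.isPointDerivation (bfvOfFun_mem_bfvDegree (f i)) _) fun j => ?_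
    have hd : br (bfvOfFun (f i)) (bfvOfFun (f j)) ∈ bfvDegree EB F V 0 := by
      simpa only [add_zero] using hg.degree 0 0 _ _
        (bfvOfFun_mem_bfvDegree (f i)) (bfvOfFun_mem_bfvDegree (f j))
    have h1 := sub_algebraMap_mem_ghostGE_one hd (zeroSection F V x)
    rwa [hbr.base, hP.bracket_eq_zero (f i).contMDiff (f j).contMDiff (hf0 i) (hf0 j), map_zero,
      sub_zero] at h1
  refine hf 1 _ (hg.isPointDerivation bfvTautological_mem_bfvDegree _) fun i => ?_
  have h2 : br (bfvTautological EB F V) (bfvOfFun (f i)) =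
      -br (bfvOfFun (f i)) (bfvTautological EB F V) := by
    rw [hg.skew 1 0 _ _ bfvTautological_mem_bfvDegree (bfvOfFun_mem_bfvDegree (f i))]
    simp
  rw [LinearMap.comp_apply, h2, map_neg]
  exact neg_mem (h i)

theorem IsGradedPoissonBracket.bracket_self_mem_bfvDegree
    (hbr : IsGradedPoissonBracket (bfvDegree EB F V) br) {Ω : BFV EB F V}
    (hΩ : Ω ∈ bfvDegree EB F V 1) : br Ω Ω ∈ bfvDegree EB F V 2 := by
  simpa only [one_add_one_eq_two] using hbr.degree 1 1 Ω Ω hΩ hΩ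

theorem IsGradedPoissonBracket.bracket_self_bracket
    (hbr : IsGradedPoissonBracket (bfvDegree EB F V) br) {Ω : BFV EB F V}
    (hΩ : Ω ∈ bfvDegree EB F V 1) : br Ω (br Ω Ω) = 0 := by
  have h1 := hbr.jacobi 1 1 Ω Ω Ω hΩ hΩ
  have h2 := hbr.skew 2 1 _ _ (hbr.bracket_self_mem_bfvDegree hΩ) hΩ
  have e1 : (((1 : ℤ) * 1).negOnePow : ℤ) = -1 := by simp
  have e2 : (((2 : ℤ) * 1).negOnePow : ℤ) = 1 := by
    rw [mul_one, Int.negOnePow_even _ even_two]; simp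
  rw [e2, one_smul] at h2
  rw [e1, h2, neg_one_smul] at h1
  exact eq_zero_of_eq_neg_add_neg h1

variable [SecondCountableTopology S]

/-- The induction step: a charge that squares to zero modulo `BFV_{≥ r}` is corrected by an
element of bidegree `(r + 2, r + 1)` to one that does so modulo `BFV_{≥ r + 1}`. -/
theorem IsBFVBracket.exists_correction
    {P : PoissonStructure (𝓘(ℝ, EB).prod 𝓘(ℝ, F)) (TotalSpace F V)} (hbr : IsBFVBracket P br)
    {Ω : BFV EB F V} (hΩ : Ω ∈ bfvDegree EB F V 1)
    (hΩ1 : Ω - bfvTautological EB F V ∈ bfvGE EB F V 1) {r : ℕ}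
    (hr : br Ω Ω ∈ bfvGE EB F V r)
    (hr0 : r = 0 → ∀ x : S, (br Ω Ω).1 (zeroSection F V x) ∈
      ghostGE (V (zeroSection F V x).proj) 1) :
    ∃ Ω' : BFV EB F V, Ω' ∈ bfvDegree EB F V 1 ∧
      Ω' - bfvTautological EB F V ∈ bfvGE EB F V 1 ∧ br Ω' Ω' ∈ bfvGE EB F V (r + 1) := by
  have hg := hbr.isGradedPoisson
  have hfin : ∀ x : S, FiniteDimensional ℝ (V x) := fun x =>
    finiteDimensional_fibre _ (mem_baseSet_trivializationAt F V x)
  obtain ⟨R, hR, hRr⟩ := exists_leading_component (k := 2) (hg.bracket_self_mem_bfvDegree hΩ) hr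
  have hδ : ∀ v, ghostContract v.snd (R.1 v) = 0 := by
    intro v
    rcases r with _ | r
    · exact ghostContract_of_mem_ghostBidegree_zero _ (hR v)
    · refine eq_zero_of_mem_ghostBidegree_of_mem_ghostGE (Nat.lt_succ_self r)
        (ghostContract_mem_ghostBidegree _ (hR v)) ?_
      have h1 := hbr.bracket_sub_ghostContract_mem hΩ hΩ1 hr v
      rw [hg.bracket_self_bracket hΩ] at h1
      have h2 : ghostContract v.snd ((br Ω Ω).1 v) ∈ ghostGE (V v.proj) (r + 1) := by
        have h3 := neg_mem h1
        rwa [ZeroMemClass.coe_zero, Pi.zero_apply, zero_sub, neg_neg] at h3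
      -- With `r + 1` in the role of `r`: the remainder `[Ω, Ω] - R` lies in filtration `r + 2`, so
      -- its contraction is in filtration `r + 1`. Thus `δR` lies there too, although its momentum
      -- degree is `r`.
      have h4 := sub_mem h2 (ghostContract_mem_ghostGE v.snd (hRr v))
      rw [← map_sub] at h4
      have h5 : (br Ω Ω).1 v - (br Ω Ω - R).1 v = R.1 v := sub_sub_cancel _ _
      rwa [h5] at h4
  have hR0 : r = 0 → ∀ x : S, R.1 (zeroSection F V x) = 0 := by
    rintro rfl x
    refine eq_zero_of_mem_ghostBidegree_of_mem_ghostGE zero_lt_one (hR _) ?_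
    have h1 := sub_mem (hr0 rfl x) (hRr (zeroSection F V x))
    have h5 : (br Ω Ω).1 (zeroSection F V x) - (br Ω Ω - R).1 (zeroSection F V x) =
      R.1 (zeroSection F V x) := sub_sub_cancel _ _
    rwa [h5] at h1
  obtain ⟨Y, hY, hYR⟩ := exists_koszul_primitive hR hδ hR0
  -- The factor is chosen so that `2 δZ = -R`, since `[Ω, Z]` enters the square of `Ω + Z` twice by
  -- symmetry on odd elements.
  set Z : BFV EB F V := (-(1 / 2) : ℝ) • Y with hZ
  have hZb : Z ∈ bfvBidegree EB F V (r + 2) (r + 1) := Submodule.smul_mem _ _ hY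
  have hZd : Z ∈ bfvDegree EB F V 1 :=
    mem_bfvDegree_of_mem_bfvBidegree (by push_cast; ring) hZb
  have hZr : Z ∈ bfvGE EB F V (r + 1) := bfvBidegree_le_bfvGE le_rfl hZb
  have hZ1 : Z ∈ bfvGE EB F V 1 := bfvGE_antitone (by omega) hZr
  refine ⟨Ω + Z, add_mem hΩ hZd, ?_, ?_⟩
  · rw [add_sub_right_comm]
    exact add_mem hΩ1 hZ1
  · have e1 : br Z Ω = br Ω Z := by
      rw [hg.skew 1 1 Z Ω hZd hΩ]
      simp
    have e2 : br (Ω + Z) (Ω + Z) =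
        (br Ω Ω - R) + ((2 : ℝ) • br Ω Z + R) + br Z Z := by
      simp only [map_add, LinearMap.add_apply, e1]
      module
    rw [e2]
    refine add_mem (add_mem hRr fun v => ?_) (hg.mem_bfvGE_of_mem_bfvGE_one hZd hZ1 hZr)
    have h1 := hbr.bracket_sub_ghostContract_mem hΩ hΩ1 hZr v
    have h2 : ghostContract v.snd (Z.1 v) = (-(1 / 2) : ℝ) • R.1 v := by
      rw [← hYR, ← map_smul]; rfl
    rw [h2] at h1
    have h3 := Submodule.smul_mem _ (2 : ℝ) h1
    have h4 : ((2 : ℝ) • br Ω Z + R).1 v =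
        (2 : ℝ) • ((br Ω Z).1 v - (-(1 / 2) : ℝ) • R.1 v) := by
      change (2 : ℝ) • (br Ω Z).1 v + R.1 v = _
      module
    rwa [h4]

/-- Coisotropy enters only in the first correction, starting from `Ω₀`; afterwards the boundary
condition on the zero section is vacuous. -/
theorem IsBFVBracket.exists_charge_modulo
    {P : PoissonStructure (𝓘(ℝ, EB).prod 𝓘(ℝ, F)) (TotalSpace F V)}
    (hP : P.IsCoisotropic 𝓘(ℝ, EB) (zeroSection F V)) (hbr : IsBFVBracket P br) (r : ℕ) :
    ∃ Ω : BFV EB F V, Ω ∈ bfvDegree EB F V 1 ∧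
      Ω - bfvTautological EB F V ∈ bfvGE EB F V 1 ∧ br Ω Ω ∈ bfvGE EB F V (r + 1) := by
  induction r with
  | zero =>
    refine hbr.exists_correction bfvTautological_mem_bfvDegree ?_ (r := 0)
      (fun v => mem_ghostGE_zero _) fun _ => hbr.tautological_bracket_mem hP
    rw [sub_self]
    exact zero_mem _
  | succ r ih =>
    obtain ⟨Ω, hΩ, hΩ1, hr⟩ := ih
    exact hbr.exists_correction hΩ hΩ1 hr fun h => absurd h (Nat.succ_ne_zero r)

end Charge

theorem proposition3p4
    {EB : Type*} [NormedAddCommGroup EB] [NormedSpace ℝ EB] [FiniteDimensional ℝ EB]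
    {S : Type*} [TopologicalSpace S] [T2Space S] [SecondCountableTopology S]
    [ChartedSpace EB S] [IsManifold 𝓘(ℝ, EB) ∞ S]
    {F : Type*} [NormedAddCommGroup F] [NormedSpace ℝ F] [FiniteDimensional ℝ F]
    {V : S → Type*} [∀ x, AddCommGroup (V x)] [∀ x, Module ℝ (V x)]
    [TopologicalSpace (TotalSpace F V)] [∀ x, TopologicalSpace (V x)]
    [FiberBundle F V] [VectorBundle ℝ F V] [ContMDiffVectorBundle ∞ F V 𝓘(ℝ, EB)]
    (P : PoissonStructure (𝓘(ℝ, EB).prod 𝓘(ℝ, F)) (TotalSpace F V))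
    (hP : P.IsCoisotropic 𝓘(ℝ, EB) (zeroSection F V))
    (br : BFV EB F V →ₗ[ℝ] BFV EB F V →ₗ[ℝ] BFV EB F V)
    (hbr : IsBFVBracket P br) :
    ∃ Ω : BFV EB F V, Ω ∈ bfvDegree EB F V 1 ∧ br Ω Ω = 0 ∧
      Ω - bfvTautological EB F V ∈ bfvGE EB F V 1 := by
  -- At this stage the square lies in filtration `rank + 1`, which is zero.
  obtain ⟨Ω, hΩ, hΩ1, h⟩ := hbr.exists_charge_modulo hP (Module.finrank ℝ F)
  exact ⟨Ω, hΩ, eq_zero_of_mem_bfvGE (Nat.lt_succ_self _) h, hΩ1⟩
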